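/- \textbf{Setting.} Let $d_v,d_h,J\in\mathbb N$, let $\{|x\rangle\}_x$ be an orthonormal basis of the $d_h$-dimensional hidden space, and for $j\in\{1,\dots,J\}$ and each $x$ let $G_v^{j,x}$ be a Hermitian operator on the $d_v$-dimensional visible space. For $\theta\in\mathbb R^J$ put $G_j=\sum_x G_v^{j,x}\otimes|x\rangle\!\langle x|_h$, $G(\theta)=\sum_j\theta_jG_j$, $G_v^x(\theta)=\sum_j\theta_jG_v^{j,x}$, and \[ \sigma_{vh}(\theta)=\frac{e^{-G(\theta)}}{\operatorname{Tr}[e^{-G(\theta)}]},\quad \sigma_v(\theta)=\operatorname{Tr}_h[\sigma_{vh}(\theta)],\quad \sigma_v^x(\theta)=\frac{e^{-G_v^x(\theta)}}{\operatorname{Tr}[e^{-G_v^x(\theta)}]},\quad p_x(\theta)=\frac{\operatorname{Tr}[e^{-G_v^x(\theta)}]}{\operatorname{Tr}[e^{-G(\theta)}]}. \] Write $\langle A\rangle_\omega=\operatorname{Tr}[A\omega]$, $\{A,B\}=AB+BA$, and, for $q\in(0,1)\cup(1,2]$, \[ Q_q(\rho\|\sigma)=\operatorname{Tr}[\rho^q\sigma^{1-q}],\qquad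 D_q(\rho\|\sigma)=\frac{Q_q(\rho\|\sigma)-1}{q-1}. \] Let $\gamma(t)=\frac2\pi\ln\left|\coth\frac{\pi t}2\right|$ and, for $r\in(-1,0)\cup(0,1)$, $\beta_r(t)=\dfrac{\sin(\pi r)}{2r(\cosh(\pi t)+\cos(\pi r))}$. Define \[ \Phi_v^{\theta,x}(Y)=\int_{-\infty}^{\infty}\gamma(t)\,e^{-iG_v^x(\theta)t}\,Y\,e^{iG_v^x(\theta)t}\,dt,\qquad \Xi_v^{\theta,q,x}(R)=\tfrac12\left\{\sigma_v^x(\theta),\ \sigma_v(\theta)^{-q/2}R\,\sigma_v(\theta)^{-q/2}\right\}, \] \[ \Upsilon_v^{\theta,q}(Y)=\int_{-\infty}^{\infty}\beta_{1-q}(t)\,\sigma_v(\theta)^{-it/2}\,Y\,\sigma_v(\theta)^{it/2}\,dt\quad(q\neq 2),\qquad \Upsilon_v^{\theta,2}(Y)=Y, \] and $\Sigma_v^{\theta,q,x}=\Phi_v^{\theta,x}\circ\Xi_v^{\theta,q,x}\circ\Upsilon_v^{\theta,q}$. (At $q=2$ the measures $\beta_{1-q}(t)\,dt$ are replaced by their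 weak limit as $q\to2^-$, the point mass at $t=0$.) \textbf{Theorem.} For every $q\in(0,1)\cup(1,2]$, every quantum state $\rho$ on the visible space (positive semidefinite, unit trace), every $\theta\in\mathbb R^J$ and every $j$, the partial derivative of $D_q(\rho\|\sigma_v(\theta))$ with respect to $\theta_j$ exists and \[ \frac{\partial}{\partial\theta_j}D_q(\rho\|\sigma_v(\theta)) =\sum_x p_x(\theta)\left\langle G_v^{j,x}\right\rangle_{\Sigma_v^{\theta,q,x}(\rho^q)} -Q_q(\rho\|\sigma_v(\theta))\sum_x p_x(\theta)\left\langle G_v^{j,x}\right\rangle_{\sigma_v^x(\theta)} . \] -/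

import Mathlib

open scoped Kronecker ComplexOrder

noncomputable section

namespace QCBoltzmann

variable {V X J : Type*} [Fintype V] [DecidableEq V] [Fintype X] [DecidableEq X] [Fintype J]

/-- Density matrices (quantum states): positive semidefinite with unit trace. -/
def IsState (ρ : Matrix V V ℂ) : Prop :=
  ρ.PosSemidef ∧ ρ.trace = 1

/-- `⟨A⟩_ρ = Tr[A ρ]`. -/
def expect (A ρ : Matrix V V ℂ) : ℂ :=
  (A * ρ).trace

/-- The real power `A ^ r` of a positive (semi)definite matrix, through the spectral
functional calculus. -/
def rpow (A : Matrix V V ℂ) (r : ℝ) : Matrix V V ℂ :=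
  cfc (fun x : ℝ => x ^ r) A

/-- The imaginary power `A ^ (i s) = exp (i s ln A)` of a positive definite matrix. -/
def ipow (A : Matrix V V ℂ) (s : ℝ) : Matrix V V ℂ :=
  NormedSpace.exp ((Complex.I * (s : ℂ)) • cfc Real.log A)

/-- The Petz-Tsallis quasi-overlap `Q_q(ρ‖σ) = Tr[ρ^q σ^(1-q)]`. -/
def petzQ (q : ℝ) (ρ σ : Matrix V V ℂ) : ℂ :=
  (rpow ρ q * rpow σ (1 - q)).trace

/-- The Petz-Tsallis relative entropy `D_q(ρ‖σ) = (Q_q(ρ‖σ) - 1) / (q - 1)`. -/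
def petzD (q : ℝ) (ρ σ : Matrix V V ℂ) : ℂ :=
  (petzQ q ρ σ - 1) / ((q : ℂ) - 1)

/-! ### The quantum-classical Boltzmann machine

`V` indexes a basis of the visible system, `X` is the distinguished orthonormal basis of the
(classical) hidden system, and `G j x` is the visible Hamiltonian `G_v^{j,x}`. -/

/-- `G_j = ∑ x, G_v^{j,x} ⊗ |x⟩⟨x|`. -/
def hamTerm (G : J → X → Matrix V V ℂ) (j : J) : Matrix (V × X) (V × X) ℂ :=
  ∑ x, G j x ⊗ₖ Matrix.single x x (1 : ℂ)

/-- `G(θ) = ∑ j, θ_j G_j`. -/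
def ham (G : J → X → Matrix V V ℂ) (θ : J → ℝ) : Matrix (V × X) (V × X) ℂ :=
  ∑ j, (θ j : ℂ) • hamTerm G j

/-- `G_v^x(θ) = ∑ j, θ_j G_v^{j,x}`. -/
def condHam (G : J → X → Matrix V V ℂ) (θ : J → ℝ) (x : X) : Matrix V V ℂ :=
  ∑ j, (θ j : ℂ) • G j x

/-- The thermal state `e^{-H} / Tr[e^{-H}]`. -/
def thermal {W : Type*} [Fintype W] [DecidableEq W] (H : Matrix W W ℂ) : Matrix W W ℂ :=
  ((NormedSpace.exp (-H)).trace)⁻¹ • NormedSpace.exp (-H)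

/-- The partial trace over the hidden system. -/
def traceHidden (M : Matrix (V × X) (V × X) ℂ) : Matrix V V ℂ :=
  Matrix.of fun a b => ∑ x, M (a, x) (b, x)

/-- The reduced state on the visible system, `σ_v(θ) = Tr_h[e^{-G(θ)} / Tr[e^{-G(θ)}]]`. -/
def visState (G : J → X → Matrix V V ℂ) (θ : J → ℝ) : Matrix V V ℂ :=
  traceHidden (thermal (ham G θ))

/-- `σ_v^x(θ) = e^{-G_v^x(θ)} / Tr[e^{-G_v^x(θ)}]`. -/
def condState (G : J → X → Matrix V V ℂ) (θ : J → ℝ) (x : X) : Matrix V V ℂ :=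
  thermal (condHam G θ x)

/-- `p_x(θ) = Tr[e^{-G_v^x(θ)}] / Tr[e^{-G(θ)}]`. -/
def prob (G : J → X → Matrix V V ℂ) (θ : J → ℝ) (x : X) : ℂ :=
  (NormedSpace.exp (-condHam G θ x)).trace / (NormedSpace.exp (-ham G θ)).trace

/-! ### The maps in the gradient formula -/

/-- The high-peak tent probability density `γ(t) = (2/π) ln |coth(πt/2)|`. -/
def tentDensity (t : ℝ) : ℝ :=
  2 / Real.pi * Real.log |Real.cosh (Real.pi * t / 2) / Real.sinh (Real.pi * t / 2)|

/-- The probability density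
`β_r(t) = sin(πr) / (2r (cosh(πt) + cos(πr)))`, for `r ∈ (-1,0) ∪ (0,1)`. -/
def powDensity (r t : ℝ) : ℝ :=
  Real.sin (Real.pi * r) /
    (2 * r * (Real.cosh (Real.pi * t) + Real.cos (Real.pi * r)))

/-- `Φ_H(Y) = ∫ dt γ(t) e^{-iHt} Y e^{iHt}`, with the matrix integral taken entrywise. -/
def tentChannel (H Y : Matrix V V ℂ) : Matrix V V ℂ :=
  Matrix.of fun a b => ∫ t : ℝ, (tentDensity t : ℂ) *
    (NormedSpace.exp ((-(Complex.I * (t : ℂ))) • H) * Y *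
      NormedSpace.exp ((Complex.I * (t : ℂ)) • H)) a b

/-- `Υ_A^r(Y) = ∫ dt β_r(t) A^{-it/2} Y A^{it/2}`, with the matrix integral taken entrywise.
At `r = -1` the formula for `β_r` degenerates: as `r → -1` the laws `β_r(t) dt` converge weakly
to the point mass at `t = 0`, and the map is given by that limit law, so it is the identity. -/
def powChannel (r : ℝ) (A Y : Matrix V V ℂ) : Matrix V V ℂ :=
  if r = -1 then Y
  else Matrix.of fun a b => ∫ t : ℝ, (powDensity r t : ℂ) *
    (ipow A (-(t / 2)) * Y * ipow A (t / 2)) a b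

/-- `Ξ_v^{θ,q,x}(R) = (1/2) {σ_v^x(θ), σ_v(θ)^{-q/2} R σ_v(θ)^{-q/2}}`. -/
def xiMap (q : ℝ) (G : J → X → Matrix V V ℂ) (θ : J → ℝ) (x : X) (R : Matrix V V ℂ) :
    Matrix V V ℂ :=
  let S := rpow (visState G θ) (-(q / 2)) * R * rpow (visState G θ) (-(q / 2))
  (1 / 2 : ℂ) • (condState G θ x * S + S * condState G θ x)

/-- `Σ_v^{θ,q,x} = Φ_v^{θ,x} ∘ Ξ_v^{θ,q,x} ∘ Υ_v^{θ,q}`, where `Φ_v^{θ,x}` is the tent channel of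
`G_v^x(θ)` and `Υ_v^{θ,q}` is the power channel of `σ_v(θ)` with density `β_{1-q}`. -/
def sigmaMap (q : ℝ) (G : J → X → Matrix V V ℂ) (θ : J → ℝ) (x : X) (R : Matrix V V ℂ) :
    Matrix V V ℂ :=
  tentChannel (condHam G θ x) (xiMap q G θ x (powChannel (1 - q) (visState G θ) R))

end QCBoltzmann

end

noncomputable section

open Complex Filter Topology MeasureTheory Matrix

namespace QCBoltzmann

/-! No perturbation theory of eigenvectors is needed, because the relevant finite differences have
exact formulas. For Hermitian `H'`, `H`, the difference `e^{-H'} - e^{-H}` is `-1/2 (e^{-H'} T + T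
e^{-H})`, where `T` is the integral of `γ(t) e^{-iH't} (H' - H) e^{iHt}`
(`exp_neg_sub_exp_neg_matrix`). Read in an eigenbasis of `H'` on the left and of `H` on the right,
every entry carries the same overlap of eigenvectors, and what remains is a scalar identity: the
Fourier transform of `γ` at `x` is `2 tanh(x/2)/x` (`mul_integral_tentDensity`). Powers work the
same way (`rpow_sub_rpow_matrix`): the transform of `β_r` is `sinh(rx)/(r sinh x)`
(`sinh_mul_integral_powDensity`), with half-logarithms as generators. For `q = 2`, that is `r = -1`,
the resolvent identity takes over. Dividing an exact increment by `s - s₀` and passing to the limit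
by dominated convergence (`tendsto_transform`) gives the derivatives of `e^{-H}` and of `A^r`. The
block structure over the hidden basis and the quotient rule then give the derivative of the visible
state (`hasMatDeriv_visState`). Finally, evenness of the densities makes both channels symmetric for
the trace pairing (`trace_mul_transform`), which moves them from `G_v^{j,x}` onto `ρ^q`; their unit
mass makes them fix commuting matrices, which reduces the normalisation term to `Q_q`. -/

/-! ### Scalar tools: partial fractions and transforms of two-sided exponentials. -/

/-- Mittag-Leffler expansion of the tangent. -/
lemma hasSum_tan {z : ℂ} (hz : z ∈ Complex.integerComplement) :
    HasSum (fun n : ℕ => 1 / ((2 * n + 1 : ℂ) - z) - 1 / ((2 * n + 1 : ℂ) + z))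
      (Real.pi / 2 * Complex.tan (Real.pi * z / 2)) := by
  have hz2 : z / 2 ∈ Complex.integerComplement := by
    rintro ⟨m, hm⟩
    exact hz ⟨2 * m, by push_cast; linear_combination 2 * hm⟩
  have hf : HasSum (fun n : ℕ => 1 / (z - (n + 1)) + 1 / (z + (n + 1)))
      (Real.pi * Complex.cot (Real.pi * z) - 1 / z) := by
    rw [cot_series_rep' hz]
    exact (summable_cotTerm hz).hasSum
  have hg : HasSum (fun n : ℕ => 1 / (z / 2 - (n + 1)) + 1 / (z / 2 + (n + 1)))
      (Real.pi * Complex.cot (Real.pi * (z / 2)) - 1 / (z / 2)) := by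
    rw [cot_series_rep' hz2]
    exact (summable_cotTerm hz2).hasSum
  -- Even indices give the poles at odd integers, which are those wanted; the value `S` is found
  -- below by subtraction.
  obtain ⟨S, he⟩ : ∃ S, HasSum (fun k : ℕ => 1 / (z - (((2 * k : ℕ) : ℂ) + 1)) +
      1 / (z + (((2 * k : ℕ) : ℂ) + 1))) S :=
    hf.summable.comp_injective (mul_right_injective₀ (two_ne_zero : (2 : ℕ) ≠ 0))
  -- Odd indices give the poles `±2(k+1)`: half the cotangent series at `z/2`.
  have ho : HasSum (fun k : ℕ => 1 / (z - (((2 * k + 1 : ℕ) : ℂ) + 1)) +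
      1 / (z + (((2 * k + 1 : ℕ) : ℂ) + 1)))
      ((1 / 2) * (Real.pi * Complex.cot (Real.pi * (z / 2)) - 1 / (z / 2))) := by
    have e : (fun k : ℕ => 1 / (z - (((2 * k + 1 : ℕ) : ℂ) + 1)) +
        1 / (z + (((2 * k + 1 : ℕ) : ℂ) + 1))) =
        fun k : ℕ => (1 / 2 : ℂ) * (1 / (z / 2 - (k + 1)) + 1 / (z / 2 + (k + 1))) := by
      funext k
      have h1 : z / 2 - (k + 1) = (z - (((2 * k + 1 : ℕ) : ℂ) + 1)) / 2 := by push_cast; ring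
      have h2 : z / 2 + (k + 1) = (z + (((2 * k + 1 : ℕ) : ℂ) + 1)) / 2 := by push_cast; ring
      rw [h1, h2, one_div_div, one_div_div]
      ring
    rw [e]
    exact hg.mul_left _
  have hu := (HasSum.even_add_odd (f := fun n : ℕ => 1 / (z - (n + 1)) + 1 / (z + (n + 1)))
    he ho).unique hf
  have hs := sin_pi_mul_ne_zero hz
  have hs2 := sin_pi_mul_ne_zero hz2
  have hd : Real.pi * z = 2 * (Real.pi * (z / 2)) := by ring
  have hc2 : Complex.cos (Real.pi * (z / 2)) ≠ 0 := by
    intro h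
    rw [hd, Complex.sin_two_mul, h] at hs
    simp at hs
  have htan : Complex.tan (Real.pi * z / 2) =
      Complex.cot (Real.pi * (z / 2)) - 2 * Complex.cot (Real.pi * z) := by
    rw [mul_div_assoc, hd]
    generalize Real.pi * (z / 2) = y at hs2 hc2
    rw [Complex.tan, Complex.cot, Complex.cot, Complex.sin_two_mul, Complex.cos_two_mul']
    field_simp
    ring
  have key : Real.pi / 2 * Complex.tan (Real.pi * z / 2) = -S := by
    have h2 : 1 / (z / 2) = 2 / z := by rw [one_div_div]
    rw [htan]
    rw [h2] at hu
    linear_combination hu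
  rw [key]
  have e : (fun n : ℕ => 1 / ((2 * n + 1 : ℂ) - z) - 1 / ((2 * n + 1 : ℂ) + z)) =
      fun k : ℕ => -(1 / (z - (((2 * k : ℕ) : ℂ) + 1)) + 1 / (z + (((2 * k : ℕ) : ℂ) + 1))) := by
    funext n
    rw [Nat.cast_mul, Nat.cast_ofNat, ← neg_sub z, one_div, one_div, one_div, one_div, inv_neg,
      add_comm z]
    ring
  rw [e]
  exact he.neg

lemma integrable_exp_neg_abs {a : ℝ} (ha : 0 < a) (x : ℝ) :
    Integrable (fun t : ℝ => Complex.exp (-(a * |t| : ℝ)) * Complex.exp (-(I * x * t))) := by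
  rw [← integrableOn_univ, ← Set.Iic_union_Ioi (a := (0 : ℝ)), integrableOn_union]
  constructor
  · refine (integrableOn_exp_mul_complex_Iic (a := a - I * x) (by simpa) 0).congr_fun ?_
      measurableSet_Iic
    intro t ht
    simp only [abs_of_nonpos (Set.mem_Iic.1 ht)]
    rw [← Complex.exp_add]
    push_cast; ring_nf
  · refine (integrableOn_exp_mul_complex_Ioi (a := -a - I * x) (by simpa) 0).congr_fun ?_
      measurableSet_Ioi
    intro t ht
    simp only [abs_of_pos (Set.mem_Ioi.1 ht)]
    rw [← Complex.exp_add]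
    push_cast; ring_nf

lemma integral_exp_neg_abs {a : ℝ} (ha : 0 < a) (x : ℝ) :
    ∫ t : ℝ, Complex.exp (-(a * |t| : ℝ)) * Complex.exp (-(I * x * t)) =
      1 / (a - I * x) + 1 / (a + I * x) := by
  have hi := integrable_exp_neg_abs ha x
  rw [← intervalIntegral.integral_Iic_add_Ioi hi.integrableOn hi.integrableOn (b := 0)]
  congr 1
  · rw [setIntegral_congr_fun (g := fun t : ℝ => Complex.exp ((a - I * x) * t)) measurableSet_Iic]
    · rw [integral_exp_mul_complex_Iic (by simpa)]; simp
    intro t ht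
    simp only [abs_of_nonpos (Set.mem_Iic.1 ht)]
    rw [← Complex.exp_add]
    push_cast; ring_nf
  · rw [setIntegral_congr_fun (g := fun t : ℝ => Complex.exp ((-a - I * x) * t)) measurableSet_Ioi]
    · rw [integral_exp_mul_complex_Ioi (by simpa)]
      simp only [ofReal_zero, mul_zero, Complex.exp_zero]
      rw [← neg_add', ← neg_div_neg_eq]; simp
    intro t ht
    simp only [abs_of_pos (Set.mem_Ioi.1 ht)]
    rw [← Complex.exp_add]
    push_cast; ring_nf

lemma integral_real_exp_neg_abs {a : ℝ} (ha : 0 < a) :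
    Integrable (fun t : ℝ => Real.exp (-(a * |t|))) ∧
      ∫ t : ℝ, Real.exp (-(a * |t|)) = 2 / a := by
  have h1 := integrable_exp_neg_abs ha 0
  have h2 := integral_exp_neg_abs ha 0
  simp only [ofReal_zero, mul_zero, zero_mul, neg_zero, Complex.exp_zero, mul_one, sub_zero,
    add_zero, ← ofReal_neg, ← ofReal_exp] at h1 h2
  refine ⟨by simpa [← ofReal_mul, ← ofReal_neg, ← ofReal_exp, -ofReal_exp, -ofReal_neg,
    -ofReal_mul] using h1.re, ?_⟩
  rw [integral_complex_ofReal] at h2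
  apply ofReal_injective
  rw [h2]; push_cast; ring


/-! ### Fourier transform of the tent density. -/

lemma two_mul_add_one_mul_pi_pos (n : ℕ) : 0 < (2 * n + 1 : ℝ) * Real.pi := by positivity

/-- With `u = e^{-π|t|}` the density is `(2/π)(ln(1+u) - ln(1-u))`, whose power series in `u` has
only odd terms. At `t = 0` the series diverges. -/
lemma hasSum_tentDensity {t : ℝ} (ht : t ≠ 0) :
    HasSum (fun n : ℕ => 4 / Real.pi / (2 * n + 1) * Real.exp (-((2 * n + 1) * Real.pi * |t|)))
      (tentDensity t) := by
  have hpi := Real.pi_pos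
  have hat : 0 < |t| := abs_pos.2 ht
  have hx : 0 < Real.pi * |t| := by positivity
  have hlt : Real.exp (-(Real.pi * |t|)) < 1 := by rw [Real.exp_lt_one_iff]; linarith
  have hpos := Real.exp_pos (-(Real.pi * |t|))
  have h := (Real.hasSum_log_sub_log_of_abs_lt_one
    (x := Real.exp (-(Real.pi * |t|))) (by rwa [abs_of_pos hpos])).mul_left (2 / Real.pi)
  have e1 : (fun n : ℕ => 4 / Real.pi / (2 * n + 1) *
      Real.exp (-((2 * n + 1) * Real.pi * |t|))) = fun k : ℕ => 2 / Real.pi *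
        ((2 : ℝ) * (1 / (2 * k + 1)) * Real.exp (-(Real.pi * |t|)) ^ (2 * k + 1)) := by
    funext n
    rw [← Real.exp_nat_mul]
    push_cast
    rw [show (2 * (n : ℝ) + 1) * -(Real.pi * |t|) = -((2 * n + 1) * Real.pi * |t|) by ring]
    ring
  have e2 : tentDensity t = 2 / Real.pi * (Real.log (1 + Real.exp (-(Real.pi * |t|))) -
      Real.log (1 - Real.exp (-(Real.pi * |t|)))) := by
    rw [tentDensity, ← Real.log_div (by positivity) (by linarith), abs_div, ← Real.cosh_abs,
      abs_of_pos (Real.cosh_pos _), Real.abs_sinh,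
      show |Real.pi * t / 2| = Real.pi * |t| / 2 by
        rw [abs_div, abs_mul, abs_of_pos hpi, abs_two]]
    congr 2
    rw [Real.cosh_eq, Real.sinh_eq]
    have hy : Real.exp (-(Real.pi * |t|)) = Real.exp (-(Real.pi * |t| / 2)) ^ 2 := by
      rw [← Real.exp_nat_mul]; congr 1; push_cast; ring
    have hz : Real.exp (Real.pi * |t| / 2) = (Real.exp (-(Real.pi * |t| / 2)))⁻¹ := by
      rw [Real.exp_neg, inv_inv]
    rw [hy] at hlt ⊢
    rw [hz]
    have h0 := Real.exp_pos (-(Real.pi * |t| / 2))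
    set u := Real.exp (-(Real.pi * |t| / 2))
    have h3 : 1 - u ^ 2 ≠ 0 := by linarith
    field_simp
  rw [e1, e2]
  exact h

lemma hasSum_integral_tentDensity (x : ℝ) :
    HasSum (fun n : ℕ => (4 / Real.pi / (2 * n + 1) : ℂ) *
        (1 / ((2 * n + 1) * Real.pi - I * x) + 1 / ((2 * n + 1) * Real.pi + I * x)))
      (∫ t : ℝ, (tentDensity t : ℂ) * Complex.exp (-(I * x * t))) := by
  set F : ℕ → ℝ → ℂ := fun n t => (4 / Real.pi / (2 * n + 1) : ℂ) *
    (Complex.exp (-((2 * n + 1) * Real.pi * |t| : ℝ)) * Complex.exp (-(I * x * t))) with hF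
  have hi : ∀ n, Integrable (F n) := fun n =>
    (integrable_exp_neg_abs (two_mul_add_one_mul_pi_pos n) x).const_mul _
  have hn : ∀ n t, ‖F n t‖ = 4 / Real.pi / (2 * n + 1) *
      Real.exp (-((2 * n + 1) * Real.pi * |t|)) := by
    intro n t
    have hc : (4 / Real.pi / (2 * n + 1) : ℂ) = ((4 / Real.pi / (2 * n + 1) : ℝ) : ℂ) := by
      push_cast; rfl
    simp only [hF]
    rw [hc, norm_mul, norm_mul, norm_real, ← ofReal_neg, Complex.norm_exp, Complex.norm_exp,
      ofReal_re, Real.norm_of_nonneg (by positivity)]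
    simp
  -- The `L¹` norms are `8/((2n+1)π)²`, so the series may be integrated term by term.
  have hs : Summable fun n => ∫ t, ‖F n t‖ := by
    simp_rw [hn, integral_const_mul]
    simp_rw [fun n : ℕ => (integral_real_exp_neg_abs (two_mul_add_one_mul_pi_pos n)).2]
    have h1 : Summable fun n : ℕ => (8 / Real.pi ^ 2) * (1 / ((n + 1 : ℕ) : ℝ) ^ 2) :=
      ((summable_nat_add_iff 1).2 (Real.summable_one_div_nat_pow.2 one_lt_two)).mul_left _
    refine h1.of_nonneg_of_le (fun n => by positivity) fun n => ?_
    have e : 4 / Real.pi / (2 * n + 1) * (2 / ((2 * n + 1) * Real.pi)) =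
      (8 / Real.pi ^ 2) * (1 / ((2 * n + 1 : ℝ)) ^ 2) := by
      field_simp; ring
    rw [e]
    gcongr
    push_cast
    linarith [Nat.cast_nonneg (α := ℝ) n]
  have h := hasSum_integral_of_summable_integral_norm hi hs
  have e1 : ∀ n, ∫ t, F n t = (4 / Real.pi / (2 * n + 1) : ℂ) *
      (1 / ((2 * n + 1) * Real.pi - I * x) + 1 / ((2 * n + 1) * Real.pi + I * x)) := by
    intro n
    simp only [hF]
    rw [integral_const_mul, integral_exp_neg_abs (two_mul_add_one_mul_pi_pos n)]
    push_cast; rfl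
  have e2 : ∫ t, ∑' n, F n t = ∫ t : ℝ, (tentDensity t : ℂ) * Complex.exp (-(I * x * t)) := by
    apply integral_congr_ae
    filter_upwards [compl_mem_ae_iff.2 (measure_singleton (0 : ℝ))] with t ht
    have h2 := (hasSum_ofReal.2 (hasSum_tentDensity ht)).mul_right
      (Complex.exp (-(I * x * t)))
    rw [← h2.tsum_eq]
    refine tsum_congr fun n => ?_
    simp only [hF]
    push_cast
    ring
  simp only [e1] at h
  rwa [e2] at h

/-- At frequency zero the integral is the sum of a positive series, hence nonzero, whereas a
non-integrable function would have integral `0` by convention. -/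
lemma integrable_tentDensity : Integrable tentDensity := by
  have h := hasSum_integral_tentDensity 0
  have h2 : (fun n : ℕ => (4 / Real.pi / (2 * n + 1) : ℂ) *
        (1 / ((2 * n + 1) * Real.pi - I * (0 : ℝ)) + 1 / ((2 * n + 1) * Real.pi + I * (0 : ℝ)))) =
      fun n : ℕ => ((8 / ((2 * n + 1) * Real.pi) ^ 2 : ℝ) : ℂ) := by
    funext n
    have : (2 * n + 1 : ℂ) ≠ 0 := by exact_mod_cast Nat.succ_ne_zero (2 * n)
    push_cast
    simp only [mul_zero, sub_zero, add_zero]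
    field_simp
    ring
  have h3 : ∫ t : ℝ, (tentDensity t : ℂ) * Complex.exp (-(I * (0 : ℝ) * t)) =
      ((∫ t : ℝ, tentDensity t : ℝ) : ℂ) := by
    rw [← integral_complex_ofReal]; simp
  rw [h2, h3, hasSum_ofReal] at h
  refine Integrable.of_integral_ne_zero (ne_of_gt ?_)
  refine lt_of_lt_of_le ?_ (le_hasSum h 0 fun n _ => by positivity)
  positivity

lemma integerComplement_of_im_ne_zero {z : ℂ} (hz : z.im ≠ 0) :
    z ∈ Complex.integerComplement := by
  rintro ⟨m, rfl⟩
  simp at hz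

/-- The Fourier transform of the high-peak tent density is `2 tanh (x / 2) / x`. -/
lemma mul_integral_tentDensity (x : ℝ) :
    x * ∫ t : ℝ, (tentDensity t : ℂ) * Complex.exp (-(I * x * t)) = 2 * Complex.tanh (x / 2) := by
  rcases eq_or_ne x 0 with rfl | hx
  · simp
  have hpi : (Real.pi : ℂ) ≠ 0 := ofReal_ne_zero.2 Real.pi_ne_zero
  have h1 := (hasSum_integral_tentDensity x).mul_left (x : ℂ)
  -- This `z` turns `πz/2` into `ix/2`, hence the tangent into a hyperbolic tangent.
  have h2 := (hasSum_tan (z := I * x / Real.pi) (integerComplement_of_im_ne_zero (by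
    rw [mul_div_assoc, ← ofReal_div, mul_comm, Complex.im_ofReal_mul, I_im, mul_one]
    exact div_ne_zero hx Real.pi_ne_zero))).mul_left (4 / (Real.pi * I))
  have e : ∀ n : ℕ, 4 / (Real.pi * I) * (1 / ((2 * n + 1 : ℂ) - I * x / Real.pi) -
      1 / ((2 * n + 1 : ℂ) + I * x / Real.pi)) = x * ((4 / Real.pi / (2 * n + 1) : ℂ) *
        (1 / ((2 * n + 1) * Real.pi - I * x) + 1 / ((2 * n + 1) * Real.pi + I * x))) := by
    intro n
    have hk : (2 * n + 1 : ℂ) ≠ 0 := by exact_mod_cast Nat.succ_ne_zero (2 * n)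
    have ha : (2 * n + 1) * (Real.pi : ℂ) - I * x ≠ 0 := fun h => hx (by
      simpa using congrArg Complex.im h)
    have hb : (2 * n + 1) * (Real.pi : ℂ) + I * x ≠ 0 := fun h => hx (by
      simpa using congrArg Complex.im h)
    have ha' : (2 * n + 1 : ℂ) - I * x / Real.pi = ((2 * n + 1) * Real.pi - I * x) / Real.pi := by
      field_simp
    have hb' : (2 * n + 1 : ℂ) + I * x / Real.pi = ((2 * n + 1) * Real.pi + I * x) / Real.pi := by
      field_simp
    rw [ha', hb', one_div_div, one_div_div, div_sub_div _ _ ha hb, div_add_div _ _ ha hb]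
    have hI := I_ne_zero
    have hD := mul_ne_zero ha hb
    generalize ((2 * n + 1) * (Real.pi : ℂ) - I * x) * ((2 * n + 1) * (Real.pi : ℂ) + I * x) = D
      at hD
    field_simp
    ring
  simp only [e] at h2
  rw [h1.unique h2, show Real.pi * (I * x / Real.pi) / 2 = x / 2 * I by field_simp,
    Complex.tan_mul_I]
  have hI := I_ne_zero
  field_simp
  ring

/-- After factoring out `e^{-(a+b)/2}`, the ratio of difference to sum is `-tanh((a-b)/2)`, which
the tent transform supplies. -/
lemma exp_neg_sub_exp_neg (a b : ℝ) :
    Complex.exp (-a) - Complex.exp (-b) = -(1 / 2) * ((Complex.exp (-a) + Complex.exp (-b)) *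
      ((a - b) * ∫ t : ℝ, (tentDensity t : ℂ) * Complex.exp (-(I * (a - b : ℝ) * t)))) := by
  have h := mul_integral_tentDensity (a - b)
  rw [← ofReal_sub, h, Complex.tanh_eq_sinh_div_cosh]
  have hc : Complex.cosh (((a - b : ℝ) : ℂ) / 2) ≠ 0 := by
    rw [show ((a - b : ℝ) : ℂ) / 2 = ((((a - b) / 2 : ℝ)) : ℂ) by push_cast; ring,
      ← ofReal_cosh]
    exact ofReal_ne_zero.2 (Real.cosh_pos _).ne'
  field_simp
  rw [Complex.cosh, Complex.sinh]
  have ha : Complex.exp (-a) =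
      Complex.exp (-((a + b) / 2)) * Complex.exp (-(((a - b : ℝ) : ℂ) / 2)) := by
    rw [← Complex.exp_add]; congr 1; push_cast; ring
  have hb : Complex.exp (-b) =
      Complex.exp (-((a + b) / 2)) * Complex.exp (((a - b : ℝ) : ℂ) / 2) := by
    rw [← Complex.exp_add]; congr 1; push_cast; ring
  rw [ha, hb]
  ring

/-! ### Fourier transform of the power density. -/

lemma one_add_cos_pi_mul_pos {r : ℝ} (h0 : -1 < r) (h1 : r < 1) :
    0 < 1 + Real.cos (Real.pi * r) := by
  have hpi := Real.pi_pos
  have h := Real.cos_pos_of_mem_Ioo (x := Real.pi * r / 2)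
    ⟨by nlinarith, by nlinarith⟩
  have := Real.cos_sq (Real.pi * r / 2)
  rw [show 2 * (Real.pi * r / 2) = Real.pi * r by ring] at this
  nlinarith

lemma cosh_add_cos_pos {r : ℝ} (h0 : -1 < r) (h1 : r < 1) (t : ℝ) :
    0 < Real.cosh (Real.pi * t) + Real.cos (Real.pi * r) := by
  linarith [one_add_cos_pi_mul_pos h0 h1, Real.one_le_cosh (Real.pi * t)]

lemma powDensity_neg (r t : ℝ) : powDensity (-r) t = powDensity r t := by
  simp [powDensity, neg_div_neg_eq]

lemma powDensity_neg_right (r t : ℝ) : powDensity r (-t) = powDensity r t := by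
  simp [powDensity]

lemma continuous_powDensity {r : ℝ} (h0 : -1 < r) (hr : r ≠ 0) (h1 : r < 1) :
    Continuous (powDensity r) := by
  unfold powDensity
  refine Continuous.div (by fun_prop) (by fun_prop) fun t =>
    mul_ne_zero (by simpa using hr) (cosh_add_cos_pos h0 h1 t).ne'

lemma integrable_powDensity {r : ℝ} (h0 : -1 < r) (hr : r ≠ 0) (h1 : r < 1) :
    Integrable (powDensity r) := by
  have hc := one_add_cos_pi_mul_pos h0 h1
  -- With `c = 1 + cos(πr) ≤ 2`, `cosh(πt) + cos(πr) ≥ (c/2) cosh(πt) ≥ (c/4) e^{π|t|}`; hence the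
  -- factor `4/c`.
  refine ((integral_real_exp_neg_abs Real.pi_pos).1.const_mul
    (|Real.sin (Real.pi * r) / (2 * r)| * (4 / (1 + Real.cos (Real.pi * r))))).mono'
    (continuous_powDensity h0 hr h1).aestronglyMeasurable (ae_of_all _ fun t => ?_)
  have hp := cosh_add_cos_pos h0 h1 t
  have hch : Real.exp (Real.pi * |t|) / 2 ≤ Real.cosh (Real.pi * t) := by
    rw [← Real.cosh_abs, abs_mul, abs_of_pos Real.pi_pos, Real.cosh_eq]
    linarith [Real.exp_pos (-(Real.pi * |t|))]
  rw [powDensity, ← div_div, Real.norm_eq_abs, abs_div, abs_of_pos hp, mul_assoc, div_eq_mul_inv]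
  refine mul_le_mul_of_nonneg_left ?_ (abs_nonneg _)
  rw [Real.exp_neg, ← div_eq_mul_inv, div_div, inv_eq_one_div, div_le_div_iff₀ hp (by positivity)]
  nlinarith [Real.one_le_cosh (Real.pi * t), Real.cos_le_one (Real.pi * r)]

lemma hasSum_sinh_div_sinh (r : ℝ) {x : ℝ} (hx : x ≠ 0) :
    HasSum (fun n : ℕ => Real.exp (-((2 * n + 1 - r) * |x|)) - Real.exp (-((2 * n + 1 + r) * |x|)))
      (Real.sinh (r * x) / Real.sinh x) := by
  have hax : 0 < |x| := abs_pos.2 hx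
  have hlt : Real.exp (-(2 * |x|)) < 1 := by rw [Real.exp_lt_one_iff]; linarith
  have h := (hasSum_geometric_of_lt_one (Real.exp_pos _).le hlt).mul_left
    (Real.exp (-|x|) * (Real.exp (r * |x|) - Real.exp (-(r * |x|))))
  have e1 : (fun n : ℕ => Real.exp (-((2 * n + 1 - r) * |x|)) -
      Real.exp (-((2 * n + 1 + r) * |x|))) = fun n : ℕ =>
      Real.exp (-|x|) * (Real.exp (r * |x|) - Real.exp (-(r * |x|))) *
        Real.exp (-(2 * |x|)) ^ n := by
    funext n
    rw [← Real.exp_nat_mul, mul_sub (Real.exp _), sub_mul (Real.exp _ * _), ← Real.exp_add,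
      ← Real.exp_add, ← Real.exp_add, ← Real.exp_add]
    congr 2 <;> ring
  have e2 : Real.sinh (r * x) / Real.sinh x = Real.sinh (r * |x|) / Real.sinh |x| := by
    rcases abs_choice x with h | h <;> rw [h]
    rw [mul_neg, Real.sinh_neg, Real.sinh_neg, neg_div_neg_eq]
  rw [e1, e2]
  convert! h using 1
  rw [Real.sinh_eq, Real.sinh_eq]
  have hy : Real.exp (-(2 * |x|)) = Real.exp (-|x|) ^ 2 := by
    rw [← Real.exp_nat_mul]; congr 1; push_cast; ring
  have hz : Real.exp |x| = (Real.exp (-|x|))⁻¹ := by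
    rw [Real.exp_neg, inv_inv]
  rw [hy] at hlt ⊢
  rw [hz]
  have h0 := Real.exp_pos (-|x|)
  set u := Real.exp (-|x|)
  have h3 : 1 - u ^ 2 ≠ 0 := by linarith
  field_simp

lemma norm_exp_neg_I_mul (x t : ℝ) : ‖Complex.exp (-(I * x * t))‖ = 1 := by
  rw [Complex.norm_exp]; simp

/-- The transform is computed in the easy direction, to be inverted later. Expanding `1/sinh`
geometrically and integrating termwise gives tangent series at `r + it` and `r - it`; the addition
formulas combine the two tangents into `β_r`. -/
lemma integral_sinh_div_sinh {r : ℝ} (h0 : 0 < r) (h1 : r < 1) (t : ℝ) :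
    ∫ x : ℝ, ((Real.sinh (r * x) / Real.sinh x : ℝ) : ℂ) * Complex.exp (-(I * t * x)) =
      (2 * Real.pi * r * powDensity r t : ℝ) := by
  have hpos1 : ∀ n : ℕ, 0 < (2 * n + 1 - r : ℝ) := fun n => by
    linarith [Nat.cast_nonneg (α := ℝ) n]
  have hpos2 : ∀ n : ℕ, 0 < (2 * n + 1 + r : ℝ) := fun n => by positivity
  set F : ℕ → ℝ → ℂ := fun n x =>
    Complex.exp (-((2 * n + 1 - r) * |x| : ℝ)) * Complex.exp (-(I * t * x)) -
    Complex.exp (-((2 * n + 1 + r) * |x| : ℝ)) * Complex.exp (-(I * t * x)) with hF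
  have hi : ∀ n, Integrable (F n) := fun n =>
    (integrable_exp_neg_abs (hpos1 n) t).sub (integrable_exp_neg_abs (hpos2 n) t)
  have hn : ∀ n x, ‖F n x‖ = Real.exp (-((2 * n + 1 - r) * |x|)) -
      Real.exp (-((2 * n + 1 + r) * |x|)) := by
    intro n x
    simp only [hF]
    rw [← sub_mul, norm_mul, norm_exp_neg_I_mul, mul_one, ← ofReal_neg, ← ofReal_neg,
      ← ofReal_exp, ← ofReal_exp, ← ofReal_sub, norm_real, Real.norm_of_nonneg]
    rw [sub_nonneg, Real.exp_le_exp]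
    nlinarith [abs_nonneg x]
  have hs : Summable fun n => ∫ x, ‖F n x‖ := by
    simp_rw [hn]
    have e : ∀ n : ℕ, ∫ x : ℝ, (Real.exp (-((2 * n + 1 - r) * |x|)) -
        Real.exp (-((2 * n + 1 + r) * |x|))) =
        4 * r / ((2 * n + 1 - r) * (2 * n + 1 + r)) := by
      intro n
      obtain ⟨i1, v1⟩ := integral_real_exp_neg_abs (hpos1 n)
      obtain ⟨i2, v2⟩ := integral_real_exp_neg_abs (hpos2 n)
      rw [integral_sub i1 i2, v1, v2, div_sub_div _ _ (hpos1 n).ne' (hpos2 n).ne']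
      congr 1
      ring
    simp_rw [e]
    -- The term `n = 0` has denominator `1 - r²`, which can be small; without it the comparison with
    -- `1/(n+1)²` holds.
    rw [← summable_nat_add_iff 1]
    have h2 : Summable fun n : ℕ => (4 * r) * (1 / ((n + 1 : ℕ) : ℝ) ^ 2) :=
      ((summable_nat_add_iff 1).2 (Real.summable_one_div_nat_pow.2 one_lt_two)).mul_left _
    refine h2.of_nonneg_of_le (fun n => ?_) fun n => ?_
    · have := hpos1 (n + 1); have := hpos2 (n + 1)
      positivity
    · rw [div_eq_mul_one_div]
      refine mul_le_mul_of_nonneg_left ?_ (by positivity)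
      refine one_div_le_one_div_of_le (by positivity) ?_
      push_cast
      nlinarith [Nat.cast_nonneg (α := ℝ) n]
  have h := hasSum_integral_of_summable_integral_norm hi hs
  have e1 : ∀ n, ∫ x, F n x =
      (1 / ((2 * n + 1 : ℂ) - (r + I * t)) - 1 / ((2 * n + 1 : ℂ) + (r + I * t))) +
      (1 / ((2 * n + 1 : ℂ) - (r - I * t)) - 1 / ((2 * n + 1 : ℂ) + (r - I * t))) := by
    intro n
    simp only [hF]
    rw [integral_sub (integrable_exp_neg_abs (hpos1 n) t) (integrable_exp_neg_abs (hpos2 n) t),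
      integral_exp_neg_abs (hpos1 n), integral_exp_neg_abs (hpos2 n)]
    push_cast
    simp only [sub_eq_add_neg, neg_add, neg_neg, add_assoc]
    ring
  have e2 : ∫ x, ∑' n, F n x =
      ∫ x : ℝ, ((Real.sinh (r * x) / Real.sinh x : ℝ) : ℂ) * Complex.exp (-(I * t * x)) := by
    apply integral_congr_ae
    filter_upwards [compl_mem_ae_iff.2 (measure_singleton (0 : ℝ))] with x hx
    have h2 := (hasSum_ofReal.2 (hasSum_sinh_div_sinh r hx)).mul_right
      (Complex.exp (-(I * t * x)))
    rw [← h2.tsum_eq]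
    refine tsum_congr fun n => ?_
    simp only [hF]
    push_cast
    ring
  have hz : ∀ s : ℝ, (r + I * s : ℂ) ∈ Complex.integerComplement := by
    rintro s ⟨m, hm⟩
    have hm' : (m : ℝ) = r := by simpa using congrArg Complex.re hm
    have a1 : 0 < m := by exact_mod_cast hm' ▸ h0
    have a2 : m < 1 := by exact_mod_cast hm' ▸ h1
    omega
  have hz2 : (r - I * t : ℂ) ∈ Complex.integerComplement := by
    simpa [sub_eq_add_neg] using hz (-t)
  have h3 := (hasSum_tan (hz t)).add (hasSum_tan hz2)
  simp only [e1] at h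
  rw [e2] at h
  rw [h.unique h3]
  have hsum : Real.pi * (r + I * t) / 2 + Real.pi * (r - I * t) / 2 = ((Real.pi * r : ℝ) : ℂ) := by
    push_cast; ring
  have hsub : Real.pi * (r + I * t) / 2 - Real.pi * (r - I * t) / 2 =
      ((Real.pi * t : ℝ) : ℂ) * I := by
    push_cast; ring
  have hcc : 2 * Complex.cos (Real.pi * (r + I * t) / 2) * Complex.cos (Real.pi * (r - I * t) / 2) =
      ((Real.cosh (Real.pi * t) + Real.cos (Real.pi * r) : ℝ) : ℂ) := by
    have e : ∀ a b : ℂ, 2 * Complex.cos a * Complex.cos b =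
        Complex.cos (a - b) + Complex.cos (a + b) := fun a b => by
      rw [Complex.cos_add, Complex.cos_sub]; ring
    rw [e, hsub, hsum, Complex.cos_mul_I]
    push_cast; rfl
  have hne : ((Real.cosh (Real.pi * t) + Real.cos (Real.pi * r) : ℝ) : ℂ) ≠ 0 :=
    ofReal_ne_zero.2 (cosh_add_cos_pos (by linarith) h1 t).ne'
  have hss : Complex.sin (Real.pi * (r + I * t) / 2) * Complex.cos (Real.pi * (r - I * t) / 2) +
      Complex.cos (Real.pi * (r + I * t) / 2) * Complex.sin (Real.pi * (r - I * t) / 2) =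
      ((Real.sin (Real.pi * r) : ℝ) : ℂ) := by
    rw [← Complex.sin_add, hsum, ofReal_sin]
  rw [← hcc] at hne
  have hc1 : Complex.cos (Real.pi * (r + I * t) / 2) ≠ 0 := by
    intro h; simp [h] at hne
  have hc2 : Complex.cos (Real.pi * (r - I * t) / 2) ≠ 0 := by
    intro h; simp [h] at hne
  have hr : (r : ℂ) ≠ 0 := ofReal_ne_zero.2 h0.ne'
  rw [powDensity, Complex.tan, Complex.tan, ← mul_add, div_add_div _ _ hc1 hc2, hss]
  rw [ofReal_mul, ofReal_div, ofReal_mul (2 * r), ← hcc]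
  push_cast
  field_simp

lemma integrable_sinh_div_sinh {r : ℝ} (h0 : 0 < r) (h1 : r < 1) :
    Integrable fun x : ℝ => ((Real.sinh (r * x) / Real.sinh x : ℝ) : ℂ) := by
  refine Integrable.of_integral_ne_zero ?_
  have h := integral_sinh_div_sinh h0 h1 0
  simp only [ofReal_zero, mul_zero, zero_mul, neg_zero, Complex.exp_zero, mul_one] at h
  rw [h, ofReal_ne_zero]
  have := cosh_add_cos_pos (by linarith) h1 0
  have hs : 0 < Real.sin (Real.pi * r) :=
    Real.sin_pos_of_pos_of_lt_pi (by positivity) (by nlinarith [Real.pi_pos])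
  unfold powDensity
  positivity

/-- Fourier inversion of `integral_sinh_div_sinh` at a continuity point. The origin is excluded
because the quotient is `0/0 = 0` there instead of its limit `r`. -/
lemma integral_powDensity_mul_exp {r : ℝ} (h0 : 0 < r) (h1 : r < 1) {x : ℝ} (hx : x ≠ 0) :
    r * ∫ t : ℝ, (powDensity r t : ℂ) * Complex.exp (I * x * t) =
      ((Real.sinh (r * x) / Real.sinh x : ℝ) : ℂ) := by
  set g : ℝ → ℂ := fun x => ((Real.sinh (r * x) / Real.sinh x : ℝ) : ℂ) with hg
  have hF : FourierTransform.fourier g =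
      fun ξ : ℝ => ((2 * Real.pi * r * powDensity r (2 * Real.pi * ξ) : ℝ) : ℂ) := by
    funext ξ
    rw [Real.fourier_real_eq_integral_exp_smul, ← integral_sinh_div_sinh h0 h1]
    refine integral_congr_ae (ae_of_all _ fun v => ?_)
    simp only [hg, smul_eq_mul]
    rw [mul_comm]
    congr 2
    push_cast; ring
  have hβ := integrable_powDensity (by linarith) h0.ne' h1
  have hFi : Integrable (FourierTransform.fourier g) := by
    rw [hF]
    exact ((hβ.comp_mul_left' (R := 2 * Real.pi) (by positivity)).const_mul _).ofReal
  have hcont : ContinuousAt g x := by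
    refine continuous_ofReal.continuousAt.comp (ContinuousAt.div ?_ ?_ ?_)
    · fun_prop
    · fun_prop
    · rwa [Ne, Real.sinh_eq_zero]
  have h := (integrable_sinh_div_sinh h0 h1).fourierInv_fourier_eq hFi hcont
  rw [Real.fourierInv_eq', hF] at h
  refine Eq.trans ?_ h
  have hpi : (0 : ℝ) < 2 * Real.pi := by positivity
  have hs := Measure.integral_comp_mul_left
    (fun t : ℝ => (powDensity r t : ℂ) * Complex.exp (I * x * t)) (2 * Real.pi)
  rw [abs_of_pos (inv_pos.2 hpi)] at hs
  have e : ∀ v : ℝ, Complex.exp (((2 * Real.pi * inner ℝ v x : ℝ) : ℂ) * I) •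
      ((2 * Real.pi * r * powDensity r (2 * Real.pi * v) : ℝ) : ℂ) =
      (r * (2 * Real.pi : ℝ) : ℂ) * ((powDensity r (2 * Real.pi * v) : ℂ) *
        Complex.exp (I * x * (2 * Real.pi * v : ℝ))) := by
    intro v
    have : Complex.exp (((2 * Real.pi * inner ℝ v x : ℝ) : ℂ) * I) =
        Complex.exp (I * x * (2 * Real.pi * v : ℝ)) := by
      congr 1
      simp only [Real.inner_apply]
      push_cast; ring
    rw [this, smul_eq_mul]
    push_cast
    ring
  simp only [e]
  rw [integral_const_mul, hs, real_smul]
  push_cast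
  field_simp

/-- The Fourier transform of `powDensity r`. -/
lemma sinh_mul_integral_powDensity {r : ℝ} (h0 : -1 < r) (hr : r ≠ 0) (h1 : r < 1) (x : ℝ) :
    Complex.sinh x * (r * ∫ t : ℝ, (powDensity r t : ℂ) * Complex.exp (-(I * x * t))) =
      Complex.sinh (r * x) := by
  rcases eq_or_ne x 0 with rfl | hx
  · simp
  -- Both sides are odd in `r`, since `β_{-r} = β_r`.
  wlog hr0 : 0 < r generalizing r
  · have h := this (r := -r) (by linarith) (by simpa) (by linarith)
      (by rcases lt_or_gt_of_ne hr with h | h <;> [linarith; exact absurd h hr0])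
    simp only [powDensity_neg] at h
    rw [ofReal_neg, neg_mul (r : ℂ) (x : ℂ), Complex.sinh_neg] at h
    linear_combination -h
  have h := integral_powDensity_mul_exp hr0 h1 (neg_ne_zero.2 hx)
  have e : ∀ t : ℝ, Complex.exp (I * (-x : ℝ) * t) = Complex.exp (-(I * x * t)) := fun t => by
    push_cast; ring_nf
  simp only [e] at h
  have hs : Real.sinh x ≠ 0 := by rwa [Ne, Real.sinh_eq_zero]
  rw [h, mul_neg, Real.sinh_neg, Real.sinh_neg, neg_div_neg_eq, ← ofReal_sinh, ← ofReal_mul,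
    mul_div_cancel₀ _ hs, ofReal_sinh, ofReal_mul]

/-! ### Unit masses, and the scalar identity for powers. -/

/-- Recovers the total mass of a weight from an identity for its Fourier transform which
degenerates at the origin. -/
lemma integral_eq_of_mul_fourier {w : ℝ → ℝ} (hw : Integrable w) {f h : ℝ → ℝ} {c : ℝ}
    (hf : HasDerivAt f 1 0) (hf0 : f 0 = 0) (hh : HasDerivAt h c 0) (hh0 : h 0 = 0)
    (e : ∀ x : ℝ, (f x : ℂ) * ∫ t : ℝ, (w t : ℂ) * Complex.exp (-(I * x * t)) = (h x : ℂ)) :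
    ∫ t : ℝ, (w t : ℂ) = c := by
  set φ : ℝ → ℂ := fun x => ∫ t : ℝ, (w t : ℂ) * Complex.exp (-(I * x * t)) with hφ
  have hc : Continuous φ := by
    refine continuous_of_dominated (bound := fun t => ‖w t‖) (fun x => ?_) (fun x => ?_)
      hw.norm (ae_of_all _ fun t => by fun_prop)
    · exact hw.ofReal.aestronglyMeasurable.mul
        (Continuous.aestronglyMeasurable (by fun_prop))
    · exact ae_of_all _ fun t => by rw [norm_mul, norm_exp_neg_I_mul, mul_one, norm_real]
  have hd := hf.ofReal_comp
  have hd2 := hh.ofReal_comp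
  rw [hasDerivAt_iff_tendsto_slope] at hd hd2
  -- The transform is continuous, so the slope of the left side at `0` tends to the mass; by `e` it
  -- is also the slope of `h`, which tends to `c`.
  have h3 := hd.mul ((hc.tendsto 0).mono_left nhdsWithin_le_nhds)
  have h4 := tendsto_nhds_unique (h3.congr fun x => ?_) hd2
  · simpa [hφ] using h4
  · simp only [slope, vsub_eq_sub, hf0, hh0, ofReal_zero, sub_zero, real_smul]
    rw [mul_assoc, e]

lemma integral_powDensity {r : ℝ} (h0 : -1 < r) (hr : r ≠ 0) (h1 : r < 1) :
    ∫ t : ℝ, (powDensity r t : ℂ) = 1 := by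
  have hh : HasDerivAt (fun x : ℝ => Real.sinh (r * x) / r) 1 0 := by
    have := ((Real.hasDerivAt_sinh (r * 0)).comp (0 : ℝ)
      ((hasDerivAt_id (0 : ℝ)).const_mul r)).div_const r
    simpa [Function.comp_def, hr] using this
  have h := integral_eq_of_mul_fourier (integrable_powDensity h0 hr h1)
    (by simpa using Real.hasDerivAt_sinh 0) Real.sinh_zero hh (by simp) fun x => ?_
  · simpa using h
  · have hr' : (r : ℂ) ≠ 0 := ofReal_ne_zero.2 hr
    have := sinh_mul_integral_powDensity h0 hr h1 x
    push_cast
    rw [← this]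
    field_simp

lemma integral_tentDensity : ∫ t : ℝ, (tentDensity t : ℂ) = 1 := by
  have hh : HasDerivAt (fun x : ℝ => 2 * Real.tanh (x / 2)) 1 0 := by
    have h2 : HasDerivAt (fun x : ℝ => x / 2) (1 / 2) 0 := (hasDerivAt_id (0 : ℝ)).div_const 2
    have h3 := (h2.sinh.fun_div h2.cosh (by simp)).const_mul 2
    simpa [Real.tanh_eq_sinh_div_cosh] using h3
  have h := integral_eq_of_mul_fourier integrable_tentDensity (hasDerivAt_id (0 : ℝ)) rfl hh
    (by simp) fun x => ?_
  · simpa using h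
  · rw [id, mul_integral_tentDensity]
    push_cast
    rfl

/-- With `u = (ln a - ln b)/2`, `a - b = 2(ab)^{1/2} sinh u` and `a^r - b^r = 2(ab)^{r/2} sinh(ru)`.
The quotient leaves `(ab)^{(r-1)/2}` times `r` times the transform of `β_r` at `u`. -/
lemma rpow_sub_rpow {r : ℝ} (h0 : -1 < r) (hr : r ≠ 0) (h1 : r < 1) {a b : ℝ} (ha : 0 < a)
    (hb : 0 < b) :
    ((a ^ r : ℝ) : ℂ) - ((b ^ r : ℝ) : ℂ) = r * (((a ^ ((r - 1) / 2) : ℝ) : ℂ) *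
      ((a - b) * ∫ t : ℝ, (powDensity r t : ℂ) *
        Complex.exp (-(I * (Real.log a / 2 - Real.log b / 2 : ℝ) * t))) *
      ((b ^ ((r - 1) / 2) : ℝ) : ℂ)) := by
  have h := sinh_mul_integral_powDensity h0 hr h1 (Real.log a / 2 - Real.log b / 2)
  have e1 : (a - b : ℂ) = 2 * ((Real.exp ((Real.log a + Real.log b) / 2) : ℝ) : ℂ) *
      Complex.sinh ((Real.log a / 2 - Real.log b / 2 : ℝ) : ℂ) := by
    rw [← ofReal_sinh, ← ofReal_sub]
    norm_cast
    rw [Real.sinh_eq, mul_div_assoc', mul_comm (2 : ℝ), mul_assoc, mul_div_assoc,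
      mul_div_cancel_left₀ _ two_ne_zero, mul_sub, ← Real.exp_add, ← Real.exp_add]
    ring_nf
    rw [Real.exp_log ha, Real.exp_log hb]
  have e2 : ((a ^ r : ℝ) : ℂ) - ((b ^ r : ℝ) : ℂ) =
      2 * ((Real.exp (r * (Real.log a + Real.log b) / 2) : ℝ) : ℂ) *
      Complex.sinh (r * (Real.log a / 2 - Real.log b / 2 : ℝ)) := by
    rw [← ofReal_mul, ← ofReal_sinh, ← ofReal_sub]
    norm_cast
    rw [Real.sinh_eq, mul_div_assoc', mul_comm (2 : ℝ), mul_assoc, mul_div_assoc,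
      mul_div_cancel_left₀ _ two_ne_zero, mul_sub, ← Real.exp_add, ← Real.exp_add,
      Real.rpow_def_of_pos ha, Real.rpow_def_of_pos hb]
    ring_nf
  have e3 : ((a ^ ((r - 1) / 2) : ℝ) : ℂ) * ((b ^ ((r - 1) / 2) : ℝ) : ℂ) *
      ((Real.exp ((Real.log a + Real.log b) / 2) : ℝ) : ℂ) =
      ((Real.exp (r * (Real.log a + Real.log b) / 2) : ℝ) : ℂ) := by
    norm_cast
    rw [Real.rpow_def_of_pos ha, Real.rpow_def_of_pos hb, ← Real.exp_add, ← Real.exp_add]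
    ring_nf
  rw [e2, e1, ← h, ← e3]
  ring

/-! ### Matrix integrals as entrywise multipliers in eigenbases. -/

section


variable {V : Type*} [Fintype V] [DecidableEq V]

/-- The matrix with eigenbasis given by the columns of `U` and eigenvalues `d`. -/
def conjDiag (U : Matrix.unitaryGroup V ℂ) (d : V → ℂ) : Matrix V V ℂ :=
  (U : Matrix V V ℂ) * diagonal d * star (U : Matrix V V ℂ)

lemma star_mul_coe (U : Matrix.unitaryGroup V ℂ) :
    star (U : Matrix V V ℂ) * (U : Matrix V V ℂ) = 1 := Unitary.coe_star_mul_self U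

lemma coe_mul_star (U : Matrix.unitaryGroup V ℂ) :
    (U : Matrix V V ℂ) * star (U : Matrix V V ℂ) = 1 := Unitary.coe_mul_star_self U

lemma star_mul_conjDiag (U : Matrix.unitaryGroup V ℂ) (d : V → ℂ) :
    star (U : Matrix V V ℂ) * conjDiag U d = diagonal d * star (U : Matrix V V ℂ) := by
  rw [conjDiag, ← Matrix.mul_assoc, ← Matrix.mul_assoc, star_mul_coe, Matrix.one_mul]

lemma conjDiag_mul_coe (U : Matrix.unitaryGroup V ℂ) (d : V → ℂ) :
    conjDiag U d * (U : Matrix V V ℂ) = U * diagonal d := by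
  rw [conjDiag, Matrix.mul_assoc, star_mul_coe, Matrix.mul_one]

lemma exp_smul_conjDiag (U : Matrix.unitaryGroup V ℂ) (c : ℂ) (d : V → ℂ) :
    NormedSpace.exp (c • conjDiag U d) = conjDiag U fun i => Complex.exp (c * d i) := by
  have hU : (U : Matrix V V ℂ)⁻¹ = star (U : Matrix V V ℂ) :=
    Matrix.inv_eq_left_inv (star_mul_coe U)
  have hu : IsUnit (U : Matrix V V ℂ) := IsUnit.of_mul_eq_one _ (coe_mul_star U)
  have e : c • conjDiag U d = U * diagonal (c • d) * (U : Matrix V V ℂ)⁻¹ := by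
    rw [conjDiag, hU, diagonal_smul, Matrix.mul_smul, Matrix.smul_mul]
  rw [e, Matrix.exp_conj _ _ hu, Matrix.exp_diagonal, hU, conjDiag]
  congr 3
  funext i
  rw [Pi.coe_exp, ← Complex.exp_eq_exp_ℂ]
  rfl

lemma cfc_eq_conjDiag {A : Matrix V V ℂ} (hA : A.IsHermitian) (f : ℝ → ℝ) :
    cfc f A = conjDiag hA.eigenvectorUnitary fun i => (f (hA.eigenvalues i) : ℂ) := by
  rw [hA.cfc_eq, Matrix.IsHermitian.cfc, Unitary.conjStarAlgAut_apply]
  rfl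

lemma eq_conjDiag {A : Matrix V V ℂ} (hA : A.IsHermitian) :
    A = conjDiag hA.eigenvectorUnitary fun i => (hA.eigenvalues i : ℂ) := by
  conv_lhs => rw [hA.spectral_theorem, Unitary.conjStarAlgAut_apply]
  rfl

/-- Conjugation by two unitaries is injective. -/
lemma ext_star_mul_mul (U' U : Matrix.unitaryGroup V ℂ) {M N : Matrix V V ℂ}
    (h : ∀ i j, (star (U' : Matrix V V ℂ) * M * U) i j = (star (U' : Matrix V V ℂ) * N * U) i j) :
    M = N := by
  have h' : star (U' : Matrix V V ℂ) * M * U = star (U' : Matrix V V ℂ) * N * U := Matrix.ext h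
  have := congrArg (fun X => (U' : Matrix V V ℂ) * X * star (U : Matrix V V ℂ)) h'
  simpa only [← Matrix.mul_assoc, coe_mul_star, Matrix.one_mul, Matrix.mul_assoc, Matrix.mul_one,
    ← Matrix.mul_assoc (U' : Matrix V V ℂ) (star _)] using this

lemma star_mul_conjDiag_mul_apply (U' : Matrix.unitaryGroup V ℂ) (d' : V → ℂ)
    (M N : Matrix V V ℂ) (i j : V) :
    (star (U' : Matrix V V ℂ) * (conjDiag U' d' * M) * N) i j =
      d' i * (star (U' : Matrix V V ℂ) * M * N) i j := by
  rw [← Matrix.mul_assoc, star_mul_conjDiag, Matrix.mul_assoc, Matrix.mul_assoc, diagonal_mul,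
    Matrix.mul_assoc]

lemma mul_conjDiag_mul_apply (U : Matrix.unitaryGroup V ℂ) (d : V → ℂ)
    (M N : Matrix V V ℂ) (i j : V) :
    (N * (M * conjDiag U d) * (U : Matrix V V ℂ)) i j =
      (N * M * (U : Matrix V V ℂ)) i j * d j := by
  rw [← Matrix.mul_assoc, Matrix.mul_assoc, conjDiag_mul_coe, ← Matrix.mul_assoc, mul_diagonal]

/-- `∫ w(t) e^{-iL't} Y e^{iLt} dt`, taken entrywise. -/
def transform (w : ℝ → ℝ) (L' L Y : Matrix V V ℂ) : Matrix V V ℂ :=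
  Matrix.of fun a b => ∫ t : ℝ, (w t : ℂ) *
    (NormedSpace.exp ((-(I * (t : ℂ))) • L') * Y * NormedSpace.exp ((I * (t : ℂ)) • L)) a b

lemma continuous_matrix_exp : Continuous (NormedSpace.exp : Matrix V V ℂ → Matrix V V ℂ) := by
  open scoped Matrix.Norms.L2Operator in
  let : NormedAlgebra ℚ (Matrix V V ℂ) := NormedAlgebra.restrictScalars ℚ ℂ _
  exact NormedSpace.exp_continuous

lemma commute_matrix_exp {A B : Matrix V V ℂ} (h : Commute A B) :
    Commute (NormedSpace.exp A) B := by
  open scoped Matrix.Norms.L2Operator in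
  let : NormedAlgebra ℚ (Matrix V V ℂ) := NormedAlgebra.restrictScalars ℚ ℂ _
  exact h.exp_left

lemma exp_I_smul_mem_unitaryGroup {L : Matrix V V ℂ} (hL : L.IsHermitian) (t : ℝ) :
    NormedSpace.exp ((I * (t : ℂ)) • L) ∈ Matrix.unitaryGroup V ℂ := by
  open scoped Matrix.Norms.L2Operator in
  let : NormedAlgebra ℚ (Matrix V V ℂ) := NormedAlgebra.restrictScalars ℚ ℂ _
  refine NormedSpace.exp_mem_unitary_of_mem_skewAdjoint ?_
  rw [skewAdjoint.mem_iff, star_smul, star_eq_conjTranspose, hL.eq]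
  simp

lemma mem_nhdsSet_spectrum {B : Matrix V V ℂ} (hB : B.PosDef) :
    Set.Ioi 0 ∈ 𝓝ˢ (spectrum ℝ B) := by
  refine isOpen_Ioi.mem_nhdsSet.2 ?_
  rw [hB.1.spectrum_real_eq_range_eigenvalues]
  rintro _ ⟨i, rfl⟩
  exact hB.eigenvalues_pos i

/-- The functional calculus is continuous in the matrix while the spectra stay inside the open
half-line on which `f` is continuous; positive definiteness ensures this. -/
lemma tendsto_cfc {X : Type*} {l : Filter X} {A : X → Matrix V V ℂ} {A₀ : Matrix V V ℂ}
    (hA : Tendsto A l (𝓝 A₀)) (h : ∀ x, (A x).PosDef) (h₀ : A₀.PosDef) {f : ℝ → ℝ}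
    (hf : ContinuousOn f (Set.Ioi 0)) : Tendsto (fun x => cfc f (A x)) l (𝓝 (cfc f A₀)) := by
  open scoped Matrix.Norms.L2Operator in
  let S : Set (Matrix V V ℂ) := {a | IsSelfAdjoint a ∧ Set.Ioi 0 ∈ 𝓝ˢ (spectrum ℝ a)}
  have hm : ∀ {B : Matrix V V ℂ}, B.PosDef → B ∈ S := fun hB => ⟨hB.1, mem_nhdsSet_spectrum hB⟩
  have h1 := (continuousOn_cfc_setProd_nhdsSet (𝕜 := ℝ) (A := Matrix V V ℂ)
    (p := IsSelfAdjoint) (s := Set.Ioi (0 : ℝ))).comp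
    (f := fun a : Matrix V V ℂ =>
      (UniformOnFun.ofFun {t | IsCompact t ∧ t ⊆ Set.Ioi (0 : ℝ)} f, a))
    (s := S) (by fun_prop) (fun a ha => ⟨hf, ha⟩)
  exact (h1 A₀ (hm h₀)).tendsto.comp
    (tendsto_nhdsWithin_iff.2 ⟨hA, Eventually.of_forall fun x => hm (h x)⟩)

lemma norm_exp_I_smul_apply_le {L : Matrix V V ℂ} (hL : L.IsHermitian) (t : ℝ) (a b : V) :
    ‖NormedSpace.exp ((I * (t : ℂ)) • L) a b‖ ≤ 1 :=
  entry_norm_bound_of_unitary (exp_I_smul_mem_unitaryGroup hL t) a b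

lemma continuous_exp_I_smul (L : Matrix V V ℂ) :
    Continuous fun t : ℝ => NormedSpace.exp ((I * (t : ℂ)) • L) :=
  continuous_matrix_exp.comp (by fun_prop)

lemma neg_I_mul_ofReal (t : ℝ) : -(I * (t : ℂ)) = I * ((-t : ℝ) : ℂ) := by push_cast; ring

lemma continuous_sandwich (L' L Y : Matrix V V ℂ) : Continuous fun t : ℝ =>
    NormedSpace.exp ((-(I * (t : ℂ))) • L') * Y * NormedSpace.exp ((I * (t : ℂ)) • L) := by
  simp only [neg_I_mul_ofReal]
  exact (((continuous_exp_I_smul L').comp continuous_neg).mul continuous_const).mul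
    (continuous_exp_I_smul L)

/-- Unitary entries have modulus at most one, so the bound depends neither on `t` nor on the
generators, as dominated convergence requires. -/
lemma norm_sandwich_apply_le {L' L : Matrix V V ℂ} (hL' : L'.IsHermitian) (hL : L.IsHermitian)
    (Y : Matrix V V ℂ) (t : ℝ) (a b : V) :
    ‖(NormedSpace.exp ((-(I * (t : ℂ))) • L') * Y *
      NormedSpace.exp ((I * (t : ℂ)) • L)) a b‖ ≤ ∑ d, ∑ c, ‖Y c d‖ := by
  rw [neg_I_mul_ofReal, Matrix.mul_apply]
  refine (norm_sum_le _ _).trans (Finset.sum_le_sum fun d _ => ?_)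
  rw [norm_mul, Matrix.mul_apply]
  refine (mul_le_of_le_one_right (norm_nonneg _) (norm_exp_I_smul_apply_le hL t d b)).trans ?_
  refine (norm_sum_le _ _).trans (Finset.sum_le_sum fun c _ => ?_)
  rw [norm_mul]
  exact mul_le_of_le_one_left (norm_nonneg _) (norm_exp_I_smul_apply_le hL' (-t) a c)

lemma integrable_sandwich {w : ℝ → ℝ} (hw : Integrable w) {L' L : Matrix V V ℂ}
    (hL' : L'.IsHermitian) (hL : L.IsHermitian) (Y : Matrix V V ℂ) (a b : V) :
    Integrable fun t : ℝ => (w t : ℂ) * (NormedSpace.exp ((-(I * (t : ℂ))) • L') * Y *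
      NormedSpace.exp ((I * (t : ℂ)) • L)) a b :=
  hw.ofReal.mul_bdd ((continuous_sandwich L' L Y).matrix_elem a b).aestronglyMeasurable
    (ae_of_all _ fun t => norm_sandwich_apply_le hL' hL Y t a b)

/-- `transform` depends continuously on its first generator and on its argument. -/
lemma tendsto_transform {X : Type*} {l : Filter X} [l.IsCountablyGenerated] {w : ℝ → ℝ}
    (hw : Integrable w) {L' : X → Matrix V V ℂ} {L : Matrix V V ℂ} (hL' : ∀ x, (L' x).IsHermitian)
    (hL : L.IsHermitian) (ht : Tendsto L' l (𝓝 L)) {Y : X → Matrix V V ℂ} {B : Matrix V V ℂ}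
    (hY : Tendsto Y l (𝓝 B)) :
    Tendsto (fun x => transform w (L' x) L (Y x)) l (𝓝 (transform w L L B)) := by
  refine tendsto_pi_nhds.2 fun a => tendsto_pi_nhds.2 fun b => ?_
  have hb : Tendsto (fun x => ∑ d, ∑ c, ‖Y x c d‖) l (𝓝 (∑ d, ∑ c, ‖B c d‖)) :=
    tendsto_finsetSum _ fun d _ => tendsto_finsetSum _ fun c _ =>
      (tendsto_pi_nhds.1 (tendsto_pi_nhds.1 hY c) d).norm
  refine tendsto_integral_filter_of_dominated_convergence
    (fun t => ‖w t‖ * (∑ d, ∑ c, ‖B c d‖ + 1)) ?_ ?_ (hw.norm.mul_const _) ?_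
  · exact Eventually.of_forall fun x => (integrable_sandwich hw (hL' x) hL (Y x) a b).1
  · filter_upwards [hb.eventually_le_const (lt_add_one _)] with x hx
    refine ae_of_all _ fun t => ?_
    rw [norm_mul, norm_real]
    exact mul_le_mul_of_nonneg_left ((norm_sandwich_apply_le (hL' x) hL (Y x) t a b).trans hx)
      (norm_nonneg _)
  · refine ae_of_all _ fun t => Tendsto.const_mul _ ?_
    have h1 : Tendsto (fun x => NormedSpace.exp ((-(I * (t : ℂ))) • L' x)) l
        (𝓝 (NormedSpace.exp ((-(I * (t : ℂ))) • L))) :=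
      (continuous_matrix_exp.tendsto _).comp (ht.const_smul _)
    exact tendsto_pi_nhds.1 (tendsto_pi_nhds.1 ((h1.mul hY).mul_const _) a) b

lemma mul_integral_mul_apply {n : Type*} [Fintype n] {M : ℝ → Matrix n n ℂ}
    (hM : ∀ a b, Integrable fun t => M t a b) (P Q : Matrix n n ℂ) (i j : n) :
    (P * Matrix.of (fun a b => ∫ t, M t a b) * Q) i j = ∫ t, (P * M t * Q) i j := by
  simp only [Matrix.mul_apply, Matrix.of_apply]
  rw [integral_finsetSum _ fun b _ =>
    (integrable_finsetSum _ fun a _ => (hM a b).const_mul _).mul_const _]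
  refine Finset.sum_congr rfl fun b _ => ?_
  rw [integral_mul_const, integral_finsetSum _ fun a _ => (hM a b).const_mul _]
  simp only [integral_const_mul]

lemma mul_transform_mul_apply {w : ℝ → ℝ} (hw : Integrable w)
    {L' L : Matrix V V ℂ} (hL' : L'.IsHermitian) (hL : L.IsHermitian)
    (P Y Q : Matrix V V ℂ) (i j : V) :
    (P * transform w L' L Y * Q) i j = ∫ t : ℝ, (w t : ℂ) * (P *
      (NormedSpace.exp ((-(I * (t : ℂ))) • L') * Y *
        NormedSpace.exp ((I * (t : ℂ)) • L)) * Q) i j := by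
  have h := mul_integral_mul_apply (M := fun t => (w t : ℂ) •
    (NormedSpace.exp ((-(I * (t : ℂ))) • L') * Y * NormedSpace.exp ((I * (t : ℂ)) • L)))
    (integrable_sandwich hw hL' hL Y) P Q i j
  refine Eq.trans h (integral_congr_ae (ae_of_all _ fun t => ?_))
  simp only
  rw [Matrix.mul_smul, Matrix.smul_mul, Matrix.smul_apply, smul_eq_mul]

/-- In the two eigenbases the exponentials multiply entry `(i, j)` by a phase of frequency `l' i - l
j`, so integration leaves the Fourier transform of the weight there. -/
lemma star_mul_transform_mul_apply {w : ℝ → ℝ} (hw : Integrable w)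
    {L' L : Matrix V V ℂ} (hL' : L'.IsHermitian) (hL : L.IsHermitian)
    {U' U : Matrix.unitaryGroup V ℂ} {l' l : V → ℝ} (e' : L' = conjDiag U' fun i => (l' i : ℂ))
    (e : L = conjDiag U fun i => (l i : ℂ)) (Y : Matrix V V ℂ) (i j : V) :
    (star (U' : Matrix V V ℂ) * transform w L' L Y * U) i j =
      (∫ t : ℝ, (w t : ℂ) * Complex.exp (-(I * (l' i - l j : ℝ) * t))) *
        (star (U' : Matrix V V ℂ) * Y * U) i j := by
  rw [mul_transform_mul_apply hw hL' hL, ← integral_mul_const]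
  refine integral_congr_ae (ae_of_all _ fun t => ?_)
  simp only
  rw [e', e, exp_smul_conjDiag,
    exp_smul_conjDiag, mul_conjDiag_mul_apply, ← Matrix.mul_assoc, Matrix.mul_assoc _ Y,
    ← Matrix.mul_assoc, star_mul_conjDiag, Matrix.mul_assoc, Matrix.mul_assoc, diagonal_mul,
    ← Matrix.mul_assoc]
  have h2 : Complex.exp (-(I * (l' i - l j : ℝ) * t)) =
      Complex.exp (-(I * t) * l' i) * Complex.exp (I * t * l j) := by
    rw [← Complex.exp_add]
    push_cast
    ring_nf
  rw [h2]
  ring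

/-- On matrices commuting with the generator, `transform` multiplies by the mass of the weight. -/
lemma transform_eq_smul_of_commute (w : ℝ → ℝ) {L Y : Matrix V V ℂ} (hL : L.IsHermitian)
    (h : Commute L Y) : transform w L L Y = (∫ t : ℝ, (w t : ℂ)) • Y := by
  ext a b
  rw [transform, Matrix.of_apply, Matrix.smul_apply, smul_eq_mul, ← integral_mul_const]
  refine integral_congr_ae (ae_of_all _ fun t => ?_)
  simp only
  have h1 := commute_matrix_exp (h.smul_left (-(I * (t : ℂ))))
  have h2 : NormedSpace.exp ((-(I * (t : ℂ))) • L) * NormedSpace.exp ((I * (t : ℂ)) • L) = 1 := by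
    have := (Matrix.mem_unitaryGroup_iff'.1 (exp_I_smul_mem_unitaryGroup hL t))
    rw [star_eq_conjTranspose, ← Matrix.exp_conjTranspose, conjTranspose_smul, hL.eq] at this
    simpa using this
  rw [h1.eq, Matrix.mul_assoc, h2, Matrix.mul_one]

lemma transform_mul_mul {w : ℝ → ℝ} (hw : Integrable w) {L P : Matrix V V ℂ}
    (hL : L.IsHermitian) (h : Commute L P) (Y : Matrix V V ℂ) :
    transform w L L (P * Y * P) = P * transform w L L Y * P := by
  ext a b
  rw [mul_transform_mul_apply hw hL hL, transform, Matrix.of_apply]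
  refine integral_congr_ae (ae_of_all _ fun t => ?_)
  simp only
  congr 2
  have h1 := commute_matrix_exp (h.smul_left (-(I * (t : ℂ))))
  have h2 := commute_matrix_exp (h.smul_left (I * (t : ℂ)))
  rw [← Matrix.mul_assoc, ← Matrix.mul_assoc, h1.eq, Matrix.mul_assoc _ P, ← h2.eq]
  simp only [Matrix.mul_assoc]

lemma trace_mul_eq_sum (U : Matrix.unitaryGroup V ℂ) (X Y : Matrix V V ℂ) :
    (X * Y).trace = ∑ i, ∑ j, (star (U : Matrix V V ℂ) * X * U) i j *
      (star (U : Matrix V V ℂ) * Y * U) j i := by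
  have h : (X * Y).trace = ((star (U : Matrix V V ℂ) * X * U) *
      (star (U : Matrix V V ℂ) * Y * U)).trace := by
    have e : (star (U : Matrix V V ℂ) * X * U) * (star (U : Matrix V V ℂ) * Y * U) =
        star (U : Matrix V V ℂ) * (X * (((U : Matrix V V ℂ) * star (U : Matrix V V ℂ)) * Y)) *
          U := by
      simp only [Matrix.mul_assoc]
    rw [e, coe_mul_star, Matrix.one_mul, Matrix.trace_mul_comm _ (U : Matrix V V ℂ),
      ← Matrix.mul_assoc, coe_mul_star, Matrix.one_mul]
  rw [h]
  rfl

/-- For an even weight, `transform` is symmetric for the trace pairing. -/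
lemma trace_mul_transform {w : ℝ → ℝ} (hw : Integrable w) (he : ∀ t, w (-t) = w t)
    {L : Matrix V V ℂ} (hL : L.IsHermitian) (X Y : Matrix V V ℂ) :
    (X * transform w L L Y).trace = (transform w L L X * Y).trace := by
  rw [trace_mul_eq_sum hL.eigenvectorUnitary, trace_mul_eq_sum hL.eigenvectorUnitary]
  refine Finset.sum_congr rfl fun i _ => Finset.sum_congr rfl fun j _ => ?_
  have e := eq_conjDiag hL
  -- Entries `(i, j)` and `(j, i)` carry opposite frequencies, which `t ↦ -t` exchanges.
  rw [star_mul_transform_mul_apply hw hL hL e e, star_mul_transform_mul_apply hw hL hL e e,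
    ← integral_neg_eq_self]
  have h2 : ∀ t : ℝ, (w (-t) : ℂ) *
      Complex.exp (-(I * (hL.eigenvalues j - hL.eigenvalues i : ℝ) * (-t : ℝ))) =
      (w t : ℂ) * Complex.exp (-(I * (hL.eigenvalues i - hL.eigenvalues j : ℝ) * t)) := by
    intro t
    rw [he]
    congr 2
    push_cast
    ring
  simp only [h2]
  ring

lemma exp_neg_eq_conjDiag {H : Matrix V V ℂ} (hH : H.IsHermitian) :
    NormedSpace.exp (-H) =
      conjDiag hH.eigenvectorUnitary fun i => Complex.exp (-(hH.eigenvalues i : ℂ)) := by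
  conv_lhs => rw [eq_conjDiag hH, ← neg_one_smul ℂ, exp_smul_conjDiag]
  simp only [neg_one_mul]

/-- Each matrix meets its own eigenbasis, so only the overlap survives. It is the same for `A' - A`
and `f(A') - f(A)`, which reduces increments to scalars. -/
lemma star_mul_conjDiag_sub_mul_apply (U' U : Matrix.unitaryGroup V ℂ) (d' d : V → ℂ) (i j : V) :
    (star (U' : Matrix V V ℂ) * (conjDiag U' d' - conjDiag U d) * (U : Matrix V V ℂ)) i j =
      (d' i - d j) * (star (U' : Matrix V V ℂ) * (U : Matrix V V ℂ)) i j := by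
  have h : star (U' : Matrix V V ℂ) * (conjDiag U' d' - conjDiag U d) * (U : Matrix V V ℂ) =
      diagonal d' * (star (U' : Matrix V V ℂ) * (U : Matrix V V ℂ)) -
        (star (U' : Matrix V V ℂ) * (U : Matrix V V ℂ)) * diagonal d := by
    rw [Matrix.mul_sub, Matrix.sub_mul, star_mul_conjDiag, Matrix.mul_assoc, Matrix.mul_assoc,
      conjDiag_mul_coe, ← Matrix.mul_assoc (star _)]
  rw [h, Matrix.sub_apply, diagonal_mul, mul_diagonal]
  ring

lemma star_mul_sub_mul_apply {A' A : Matrix V V ℂ} {U' U : Matrix.unitaryGroup V ℂ}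
    {l' l : V → ℝ} (e' : A' = conjDiag U' fun i => (l' i : ℂ))
    (e : A = conjDiag U fun i => (l i : ℂ)) (i j : V) :
    (star (U' : Matrix V V ℂ) * (A' - A) * (U : Matrix V V ℂ)) i j =
      (l' i - l j) * (star (U' : Matrix V V ℂ) * (U : Matrix V V ℂ)) i j := by
  rw [e', e, star_mul_conjDiag_sub_mul_apply]

/-! ### Exact increments of matrix functions. -/

/-- Exact increment of the matrix exponential. -/
lemma exp_neg_sub_exp_neg_matrix {H' H : Matrix V V ℂ} (hH' : H'.IsHermitian)
    (hH : H.IsHermitian) :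
    NormedSpace.exp (-H') - NormedSpace.exp (-H) = (-(1 / 2) : ℂ) •
      (NormedSpace.exp (-H') * transform tentDensity H' H (H' - H) +
        transform tentDensity H' H (H' - H) * NormedSpace.exp (-H)) := by
  refine ext_star_mul_mul hH'.eigenvectorUnitary hH.eigenvectorUnitary fun i j => ?_
  have e' := eq_conjDiag hH'
  have e := eq_conjDiag hH
  rw [exp_neg_eq_conjDiag hH', exp_neg_eq_conjDiag hH, star_mul_conjDiag_sub_mul_apply,
    exp_neg_sub_exp_neg,
    Matrix.mul_smul, Matrix.smul_mul, Matrix.smul_apply, Matrix.mul_add, Matrix.add_mul,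
    Matrix.add_apply, star_mul_conjDiag_mul_apply, mul_conjDiag_mul_apply,
    star_mul_transform_mul_apply integrable_tentDensity hH' hH e' e,
    star_mul_sub_mul_apply e' e, smul_eq_mul]
  ring

lemma isHermitian_cfc (f : ℝ → ℝ) (A : Matrix V V ℂ) : (cfc f A).IsHermitian :=
  cfc_predicate f A

lemma powChannel_eq {r : ℝ} (hr : r ≠ -1) (A Y : Matrix V V ℂ) :
    powChannel r A Y = transform (powDensity r) ((1 / 2 : ℂ) • cfc Real.log A)
      ((1 / 2 : ℂ) • cfc Real.log A) Y := by
  have e : ∀ t : ℝ, I * ((t / 2 : ℝ) : ℂ) = I * t * (1 / 2) := fun t => by push_cast; ring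
  have e' : ∀ t : ℝ, I * ((-(t / 2) : ℝ) : ℂ) = -(I * t) * (1 / 2) := fun t => by
    push_cast; ring
  simp only [powChannel, if_neg hr, transform, ipow, smul_smul, e, e']

lemma half_log_eq_conjDiag {A : Matrix V V ℂ} (hA : A.IsHermitian) :
    (1 / 2 : ℂ) • cfc Real.log A =
      conjDiag hA.eigenvectorUnitary fun i => ((Real.log (hA.eigenvalues i) / 2 : ℝ) : ℂ) := by
  rw [cfc_eq_conjDiag hA, conjDiag, conjDiag, ← Matrix.smul_mul, ← Matrix.mul_smul,
    ← diagonal_smul]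
  congr 3
  funext i
  rw [Pi.smul_apply, smul_eq_mul]
  push_cast
  ring

lemma isHermitian_half_log (A : Matrix V V ℂ) :
    ((1 / 2 : ℂ) • cfc Real.log A).IsHermitian := by
  rw [IsHermitian, conjTranspose_smul, isHermitian_cfc]
  simp

lemma rpow_eq_conjDiag {A : Matrix V V ℂ} (hA : A.IsHermitian) (p : ℝ) :
    rpow A p = conjDiag hA.eigenvectorUnitary fun i => ((hA.eigenvalues i ^ p : ℝ) : ℂ) :=
  cfc_eq_conjDiag hA _

/-- Exact increment of a real power of a positive definite matrix. -/
lemma rpow_sub_rpow_matrix {r : ℝ} (h0 : -1 < r) (hr : r ≠ 0) (h1 : r < 1) {A' A : Matrix V V ℂ}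
    (hA' : A'.PosDef) (hA : A.PosDef) :
    rpow A' r - rpow A r = (r : ℂ) • (rpow A' ((r - 1) / 2) *
      transform (powDensity r) ((1 / 2 : ℂ) • cfc Real.log A') ((1 / 2 : ℂ) • cfc Real.log A)
        (A' - A) * rpow A ((r - 1) / 2)) := by
  refine ext_star_mul_mul hA'.1.eigenvectorUnitary hA.1.eigenvectorUnitary fun i j => ?_
  rw [rpow_eq_conjDiag hA'.1 r, rpow_eq_conjDiag hA.1 r, rpow_eq_conjDiag hA'.1 ((r - 1) / 2),
    rpow_eq_conjDiag hA.1 ((r - 1) / 2), star_mul_conjDiag_sub_mul_apply,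
    rpow_sub_rpow h0 hr h1 (hA'.eigenvalues_pos i) (hA.eigenvalues_pos j),
    Matrix.mul_smul, Matrix.smul_mul, Matrix.smul_apply, mul_conjDiag_mul_apply,
    star_mul_conjDiag_mul_apply,
    star_mul_transform_mul_apply (integrable_powDensity h0 hr h1) (isHermitian_half_log A')
      (isHermitian_half_log A) (half_log_eq_conjDiag hA'.1) (half_log_eq_conjDiag hA.1),
    star_mul_sub_mul_apply (eq_conjDiag hA'.1) (eq_conjDiag hA.1), smul_eq_mul]
  ring

/-- The resolvent identity, written in the shape of `rpow_sub_rpow_matrix` with exponent `(r-1)/2 =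
-1` and no averaging. It serves `q = 2`. -/
lemma rpow_neg_one_sub_matrix {A' A : Matrix V V ℂ} (hA' : A'.PosDef) (hA : A.PosDef) :
    rpow A' (-1) - rpow A (-1) = (-1 : ℂ) • (rpow A' (-1) * (A' - A) * rpow A (-1)) := by
  refine ext_star_mul_mul hA'.1.eigenvectorUnitary hA.1.eigenvectorUnitary fun i j => ?_
  rw [rpow_eq_conjDiag hA'.1, rpow_eq_conjDiag hA.1, star_mul_conjDiag_sub_mul_apply,
    Matrix.mul_smul, Matrix.smul_mul, Matrix.smul_apply, mul_conjDiag_mul_apply,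
    star_mul_conjDiag_mul_apply,
    star_mul_sub_mul_apply (eq_conjDiag hA'.1) (eq_conjDiag hA.1), smul_eq_mul]
  have ha : (hA'.1.eigenvalues i : ℂ) ≠ 0 := ofReal_ne_zero.2 (hA'.eigenvalues_pos i).ne'
  have hb : (hA.1.eigenvalues j : ℂ) ≠ 0 := ofReal_ne_zero.2 (hA.eigenvalues_pos j).ne'
  rw [Real.rpow_neg_one, Real.rpow_neg_one]
  push_cast
  field_simp
  ring

end

/-! ### Derivatives of matrix exponentials and powers. -/

section

variable {V : Type*}

/-- Entrywise differentiability of a matrix-valued function of a real variable. -/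
def HasMatDeriv (M : ℝ → Matrix V V ℂ) (B : Matrix V V ℂ) (s₀ : ℝ) : Prop :=
  ∀ a b, HasDerivAt (fun s => M s a b) (B a b) s₀

lemma hasMatDeriv_iff {M : ℝ → Matrix V V ℂ} {B : Matrix V V ℂ} {s₀ : ℝ} :
    HasMatDeriv M B s₀ ↔
      Tendsto (fun s => ((s - s₀ : ℝ) : ℂ)⁻¹ • (M s - M s₀)) (𝓝[≠] s₀) (𝓝 B) := by
  have key : ∀ a b, HasDerivAt (fun s => M s a b) (B a b) s₀ ↔
      Tendsto (fun s => (((s - s₀ : ℝ) : ℂ)⁻¹ • (M s - M s₀)) a b) (𝓝[≠] s₀) (𝓝 (B a b)) := by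
    intro a b
    rw [hasDerivAt_iff_tendsto_slope]
    have : slope (fun s => M s a b) s₀ =
        fun s => (((s - s₀ : ℝ) : ℂ)⁻¹ • (M s - M s₀)) a b := by
      funext s
      rw [slope, vsub_eq_sub, Matrix.smul_apply, Matrix.sub_apply, ← ofReal_inv, real_smul,
        smul_eq_mul]
    rw [this]
  exact ⟨fun h => tendsto_pi_nhds.2 fun a => tendsto_pi_nhds.2 fun b => (key a b).1 (h a b),
    fun h a b => (key a b).2 (tendsto_pi_nhds.1 (tendsto_pi_nhds.1 h a) b)⟩

lemma HasMatDeriv.tendsto {M : ℝ → Matrix V V ℂ} {B : Matrix V V ℂ} {s₀ : ℝ}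
    (h : HasMatDeriv M B s₀) : Tendsto M (𝓝[≠] s₀) (𝓝 (M s₀)) :=
  tendsto_pi_nhds.2 fun a => tendsto_pi_nhds.2 fun b =>
    (h a b).continuousAt.tendsto.mono_left nhdsWithin_le_nhds

lemma HasMatDeriv.trace [Fintype V] {M : ℝ → Matrix V V ℂ} {B : Matrix V V ℂ} {s₀ : ℝ}
    (h : HasMatDeriv M B s₀) : HasDerivAt (fun s => (M s).trace) B.trace s₀ := by
  simp only [Matrix.trace, Matrix.diag]
  exact HasDerivAt.fun_sum fun i _ => h i i

lemma HasMatDeriv.trace_const_mul [Fintype V] {M : ℝ → Matrix V V ℂ} {B : Matrix V V ℂ} {s₀ : ℝ}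
    (h : HasMatDeriv M B s₀) (R : Matrix V V ℂ) :
    HasDerivAt (fun s => (R * M s).trace) (R * B).trace s₀ := by
  simp only [Matrix.trace, Matrix.diag, Matrix.mul_apply]
  exact HasDerivAt.fun_sum fun i _ => HasDerivAt.fun_sum fun j _ => (h j i).const_mul _

end

section

variable {V : Type*} [Fintype V] [DecidableEq V]

lemma transform_smul (w : ℝ → ℝ) (L' L Y : Matrix V V ℂ) (c : ℂ) :
    transform w L' L (c • Y) = c • transform w L' L Y := by
  ext a b
  simp only [transform, Matrix.of_apply, Matrix.smul_apply, smul_eq_mul]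
  rw [← integral_const_mul]
  refine integral_congr_ae (ae_of_all _ fun t => ?_)
  simp only [Matrix.mul_smul, Matrix.smul_mul, Matrix.smul_apply, smul_eq_mul]
  ring

/-- The difference quotient passes inside the linear transform of the exact increment; in the limit
both generators agree and the transform becomes the tent channel. -/
lemma HasMatDeriv.exp_neg {H : ℝ → Matrix V V ℂ} {B : Matrix V V ℂ} {s₀ : ℝ}
    (h : HasMatDeriv H B s₀) (hH : ∀ s, (H s).IsHermitian) :
    HasMatDeriv (fun s => NormedSpace.exp (-H s)) ((-(1 / 2) : ℂ) •
      (NormedSpace.exp (-H s₀) * tentChannel (H s₀) B +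
        tentChannel (H s₀) B * NormedSpace.exp (-H s₀))) s₀ := by
  have hc := h.tendsto
  have hexp : Tendsto (fun s => NormedSpace.exp (-H s)) (𝓝[≠] s₀)
      (𝓝 (NormedSpace.exp (-H s₀))) := (continuous_matrix_exp.tendsto _).comp hc.neg
  have hT := tendsto_transform integrable_tentDensity hH (hH s₀) hc (hasMatDeriv_iff.1 h)
  rw [hasMatDeriv_iff]
  refine (((hexp.mul hT).add (hT.mul_const (NormedSpace.exp (-H s₀)))).const_smul
    (-(1 / 2) : ℂ)).congr fun s => ?_
  rw [exp_neg_sub_exp_neg_matrix (hH s) (hH s₀), transform_smul, smul_comm, smul_add, smul_add,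
    Matrix.mul_smul, Matrix.smul_mul]
  simp only [smul_add]

lemma HasMatDeriv.rpow {A : ℝ → Matrix V V ℂ} {B : Matrix V V ℂ} {s₀ : ℝ}
    (h : HasMatDeriv A B s₀) (hA : ∀ s, (A s).PosDef) {r : ℝ} (h0 : -1 ≤ r) (hr : r ≠ 0)
    (h1 : r < 1) :
    HasMatDeriv (fun s => QCBoltzmann.rpow (A s) r) ((r : ℂ) •
      (QCBoltzmann.rpow (A s₀) ((r - 1) / 2) * powChannel r (A s₀) B *
        QCBoltzmann.rpow (A s₀) ((r - 1) / 2))) s₀ := by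
  have hc := h.tendsto
  have hp : ∀ p : ℝ, Tendsto (fun s => QCBoltzmann.rpow (A s) p) (𝓝[≠] s₀)
      (𝓝 (QCBoltzmann.rpow (A s₀) p)) := fun p =>
    tendsto_cfc hc hA (hA s₀) fun x hx =>
      (Real.continuousAt_rpow_const x p (Or.inl (Set.mem_Ioi.1 hx).ne')).continuousWithinAt
  rw [hasMatDeriv_iff]
  rcases h0.eq_or_lt with rfl | h0
  · have e : ((-1 : ℝ) - 1) / 2 = -1 := by norm_num
    rw [powChannel, if_pos rfl, e]
    refine ((((hp (-1)).mul (hasMatDeriv_iff.1 h)).mul_const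
      (QCBoltzmann.rpow (A s₀) (-1))).const_smul ((-1 : ℝ) : ℂ)).congr fun s => ?_
    rw [rpow_neg_one_sub_matrix (hA s) (hA s₀), smul_comm, Matrix.mul_smul, Matrix.smul_mul]
    push_cast
    rfl
  · have hlog : Tendsto (fun s => (1 / 2 : ℂ) • cfc Real.log (A s)) (𝓝[≠] s₀)
        (𝓝 ((1 / 2 : ℂ) • cfc Real.log (A s₀))) :=
      (tendsto_cfc hc hA (hA s₀) fun x hx =>
        (Real.continuousAt_log (Set.mem_Ioi.1 hx).ne').continuousWithinAt).const_smul _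
    have hT := tendsto_transform (integrable_powDensity h0 hr h1)
      (fun s => isHermitian_half_log (A s)) (isHermitian_half_log (A s₀)) hlog
      (hasMatDeriv_iff.1 h)
    rw [powChannel_eq h0.ne']
    refine ((((hp _).mul hT).mul_const
      (QCBoltzmann.rpow (A s₀) ((r - 1) / 2))).const_smul (r : ℂ)).congr fun s => ?_
    rw [rpow_sub_rpow_matrix h0 hr h1 (hA s) (hA s₀), transform_smul, smul_comm, Matrix.mul_smul,
      Matrix.smul_mul]

/-! ### Trace symmetry and fixed points of the channels. -/

lemma tentDensity_neg (t : ℝ) : tentDensity (-t) = tentDensity t := by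
  rw [tentDensity, tentDensity, mul_neg, neg_div, Real.cosh_neg, Real.sinh_neg, div_neg, abs_neg]

lemma trace_mul_tentChannel {H : Matrix V V ℂ} (hH : H.IsHermitian) (X Y : Matrix V V ℂ) :
    (X * tentChannel H Y).trace = (tentChannel H X * Y).trace :=
  trace_mul_transform integrable_tentDensity tentDensity_neg hH X Y

lemma tentChannel_exp_neg {H : Matrix V V ℂ} (hH : H.IsHermitian) :
    tentChannel H (NormedSpace.exp (-H)) = NormedSpace.exp (-H) := by
  have h : Commute H (NormedSpace.exp (-H)) :=
    (commute_matrix_exp (Commute.refl H).neg_left).symm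
  refine (transform_eq_smul_of_commute tentDensity hH h).trans ?_
  rw [integral_tentDensity, one_smul]

lemma commute_cfc (f g : ℝ → ℝ) (A : Matrix V V ℂ) : Commute (cfc f A) (cfc g A) :=
  cfc_commute_cfc f g A

/-- The trace pairing with a power channel, dressed by commuting powers. -/
lemma trace_mul_rpow_powChannel {r : ℝ} (h0 : -1 ≤ r) (hr : r ≠ 0) (h1 : r < 1)
    (A R Y : Matrix V V ℂ) (p : ℝ) :
    (R * (rpow A p * powChannel r A Y * rpow A p)).trace =
      (rpow A p * powChannel r A R * rpow A p * Y).trace := by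
  have e : ∀ Z : Matrix V V ℂ, (R * (rpow A p * Z * rpow A p)).trace =
      (rpow A p * R * rpow A p * Z).trace := fun Z => by
    rw [← Matrix.mul_assoc, Matrix.trace_mul_comm]
    simp only [Matrix.mul_assoc]
  rw [e]
  rcases h0.eq_or_lt with rfl | h0
  · rw [powChannel, if_pos rfl, powChannel, if_pos rfl]
  · rw [powChannel_eq h0.ne', powChannel_eq h0.ne',
      trace_mul_transform (integrable_powDensity h0 hr h1) (powDensity_neg_right r)
        (isHermitian_half_log A),
      transform_mul_mul (P := rpow A p) (integrable_powDensity h0 hr h1) (isHermitian_half_log A)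
        ((commute_cfc _ _ A).smul_left _)]

/-- `A` commutes with its logarithm and the density has mass one. -/
lemma powChannel_self {r : ℝ} (h0 : -1 ≤ r) (hr : r ≠ 0) (h1 : r < 1) {A : Matrix V V ℂ}
    (hA : A.IsHermitian) : powChannel r A A = A := by
  rcases h0.eq_or_lt with rfl | h0
  · rw [powChannel, if_pos rfl]
  · rw [powChannel_eq h0.ne']
    have h : Commute ((1 / 2 : ℂ) • cfc Real.log A) A := by
      have e : cfc (id : ℝ → ℝ) A = A := cfc_id ℝ A hA
      have := commute_cfc Real.log id A
      rw [e] at this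
      exact this.smul_left _
    rw [transform_eq_smul_of_commute _ (isHermitian_half_log A) h, integral_powDensity h0 hr h1,
      one_smul]

lemma conjDiag_mul_conjDiag (U : Matrix.unitaryGroup V ℂ) (d d' : V → ℂ) :
    conjDiag U d * conjDiag U d' = conjDiag U fun i => d i * d' i := by
  rw [conjDiag, Matrix.mul_assoc, star_mul_conjDiag, ← Matrix.mul_assoc, Matrix.mul_assoc _ _
    (diagonal d'), diagonal_mul_diagonal, conjDiag]

lemma rpow_mul_self_mul_rpow {A : Matrix V V ℂ} (hA : A.PosDef) (r : ℝ) :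
    rpow A ((r - 1) / 2) * A * rpow A ((r - 1) / 2) = rpow A r := by
  have h := congrArg₂ (· * ·) (congrArg₂ (· * ·) (rpow_eq_conjDiag hA.1 ((r - 1) / 2))
    (eq_conjDiag hA.1)) (rpow_eq_conjDiag hA.1 ((r - 1) / 2))
  refine h.trans ?_
  rw [conjDiag_mul_conjDiag, conjDiag_mul_conjDiag, rpow_eq_conjDiag hA.1]
  congr 1
  funext i
  have hi := hA.eigenvalues_pos i
  rw [← ofReal_mul, ← ofReal_mul, ofReal_inj]
  nth_rewrite 2 [← Real.rpow_one (hA.1.eigenvalues i)]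
  rw [← Real.rpow_add hi, ← Real.rpow_add hi]
  ring_nf

end

lemma posDef_exp_neg {V : Type*} [Fintype V] [DecidableEq V] {H : Matrix V V ℂ}
    (hH : H.IsHermitian) : (NormedSpace.exp (-H)).PosDef := by
  have hu : IsUnit (hH.eigenvectorUnitary : Matrix V V ℂ) :=
    IsUnit.of_mul_eq_one _ (coe_mul_star _)
  rw [exp_neg_eq_conjDiag hH, conjDiag]
  rw [Matrix.IsUnit.posDef_star_right_conjugate_iff hu, posDef_diagonal_iff]
  intro i
  rw [← ofReal_neg, ← ofReal_exp]
  exact_mod_cast Real.exp_pos _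

/-! ### The Boltzmann machine: block structure and derivative of the visible state. -/

section

variable {V X J : Type*} [Fintype J]

lemma isHermitian_condHam {G : J → X → Matrix V V ℂ} (hG : ∀ j x, (G j x).IsHermitian)
    (θ : J → ℝ) (x : X) : (condHam G θ x).IsHermitian := by
  rw [condHam, IsHermitian, conjTranspose_sum]
  refine Finset.sum_congr rfl fun j _ => ?_
  rw [conjTranspose_smul, (hG j x).eq]
  simp

lemma hasMatDeriv_condHam [DecidableEq J] (G : J → X → Matrix V V ℂ) (θ : J → ℝ) (j : J) (x : X) :
    HasMatDeriv (fun s => condHam G (Function.update θ j s) x) (G j x) (θ j) := by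
  intro a b
  simp only [condHam, Matrix.sum_apply, Matrix.smul_apply, smul_eq_mul]
  have h : ∀ i ∈ Finset.univ, HasDerivAt (fun s => (Function.update θ j s i : ℂ) * G i x a b)
      (if i = j then G i x a b else 0) (θ j) := by
    intro i _
    split_ifs with hi
    · subst hi
      simp only [Function.update_self]
      simpa using ((hasDerivAt_id (θ i)).ofReal_comp).mul_const (G i x a b)
    · simp only [Function.update_of_ne hi]
      exact hasDerivAt_const _ _
  simpa using HasDerivAt.fun_sum h

/-- Since the hidden system is classical, the exponential, its trace and its partial trace all split
over `x`. -/
lemma ham_eq_blockDiagonal [Fintype X] [DecidableEq X] (G : J → X → Matrix V V ℂ) (θ : J → ℝ) :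
    ham G θ = blockDiagonal (condHam G θ) := by
  ext ⟨a, x⟩ ⟨b, y⟩
  rw [blockDiagonal_apply]
  simp only [ham, hamTerm, condHam, Matrix.sum_apply, Matrix.smul_apply, kroneckerMap_apply,
    Matrix.single_apply, smul_eq_mul]
  split_ifs with h
  · subst h
    simp
  · refine Finset.sum_eq_zero fun j _ => ?_
    rw [Finset.sum_eq_zero, mul_zero]
    rintro c -
    rw [if_neg, mul_zero]
    rintro ⟨rfl, rfl⟩
    exact h rfl

end

variable {V X J : Type*} [Fintype V] [DecidableEq V] [Fintype X] [DecidableEq X] [Fintype J]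

lemma exp_neg_ham (G : J → X → Matrix V V ℂ) (θ : J → ℝ) :
    NormedSpace.exp (-ham G θ) = blockDiagonal fun x => NormedSpace.exp (-condHam G θ x) := by
  rw [ham_eq_blockDiagonal, ← blockDiagonal_neg, Matrix.exp_blockDiagonal]
  congr 1
  funext x
  open scoped Matrix.Norms.L2Operator in
  let : NormedAlgebra ℚ (Matrix V V ℂ) := NormedAlgebra.restrictScalars ℚ ℂ _
  exact Pi.coe_exp _ x

lemma trace_exp_neg_ham (G : J → X → Matrix V V ℂ) (θ : J → ℝ) :
    (NormedSpace.exp (-ham G θ)).trace = ∑ x, (NormedSpace.exp (-condHam G θ x)).trace := by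
  rw [exp_neg_ham, trace_blockDiagonal]

lemma visState_eq (G : J → X → Matrix V V ℂ) (θ : J → ℝ) :
    visState G θ = ((NormedSpace.exp (-ham G θ)).trace)⁻¹ •
      ∑ x, NormedSpace.exp (-condHam G θ x) := by
  ext a b
  simp only [visState, traceHidden, thermal, Matrix.of_apply, Matrix.smul_apply, Matrix.sum_apply,
    smul_eq_mul, Finset.mul_sum]
  refine Finset.sum_congr rfl fun x _ => ?_
  rw [exp_neg_ham, blockDiagonal_apply, if_pos rfl]

lemma trace_exp_neg_pos [Nonempty V] {H : Matrix V V ℂ} (hH : H.IsHermitian) :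
    0 < (NormedSpace.exp (-H)).trace := (posDef_exp_neg hH).trace_pos

lemma trace_exp_neg_ham_pos [Nonempty V] [Nonempty X] {G : J → X → Matrix V V ℂ}
    (hG : ∀ j x, (G j x).IsHermitian) (θ : J → ℝ) : 0 < (NormedSpace.exp (-ham G θ)).trace := by
  rw [trace_exp_neg_ham]
  exact Finset.sum_pos (fun x _ => trace_exp_neg_pos (isHermitian_condHam hG θ x))
    Finset.univ_nonempty

lemma posDef_visState [Nonempty V] [Nonempty X] {G : J → X → Matrix V V ℂ}
    (hG : ∀ j x, (G j x).IsHermitian) (θ : J → ℝ) : (visState G θ).PosDef := by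
  rw [visState_eq]
  refine PosDef.smul ?_ (inv_pos.2 (trace_exp_neg_ham_pos hG θ))
  exact posDef_sum Finset.univ_nonempty fun x _ => posDef_exp_neg (isHermitian_condHam hG θ x)

lemma prob_smul_condState [Nonempty V] {G : J → X → Matrix V V ℂ}
    (hG : ∀ j x, (G j x).IsHermitian) (θ : J → ℝ) (x : X) :
    prob G θ x • condState G θ x =
      ((NormedSpace.exp (-ham G θ)).trace)⁻¹ • NormedSpace.exp (-condHam G θ x) := by
  rw [prob, condState, thermal, smul_smul]
  congr 1
  have := (trace_exp_neg_pos (isHermitian_condHam hG θ x)).ne'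
  field_simp

/-- Product rule for `Z⁻¹ ∑ e^{-G_v^x}`: the sum yields the anticommutators, and `Z⁻¹` yields the
multiple of the state. -/
lemma hasMatDeriv_visState [DecidableEq J] [Nonempty V] [Nonempty X] {G : J → X → Matrix V V ℂ}
    (hG : ∀ j x, (G j x).IsHermitian) (θ : J → ℝ) (j : J) :
    HasMatDeriv (fun s => visState G (Function.update θ j s))
      ((-(1 / 2) : ℂ) • ∑ x, prob G θ x • (condState G θ x * tentChannel (condHam G θ x) (G j x) +
          tentChannel (condHam G θ x) (G j x) * condState G θ x) +
        (∑ x, prob G θ x * expect (G j x) (condState G θ x)) • visState G θ) (θ j) := by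
  have hH := isHermitian_condHam hG
  have hE : ∀ x, HasMatDeriv
      (fun s => NormedSpace.exp (-condHam G (Function.update θ j s) x)) ((-(1 / 2) : ℂ) •
      (NormedSpace.exp (-condHam G θ x) * tentChannel (condHam G θ x) (G j x) +
        tentChannel (condHam G θ x) (G j x) * NormedSpace.exp (-condHam G θ x))) (θ j) := by
    intro x
    have h := (hasMatDeriv_condHam G θ j x).exp_neg fun s => hH _ x
    rwa [Function.update_eq_self] at h
  -- Cyclicity merges the two terms; the tent channel then moves onto `e^{-H}`, which it fixes.
  have htr : ∀ x, ((-(1 / 2) : ℂ) •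
      (NormedSpace.exp (-condHam G θ x) * tentChannel (condHam G θ x) (G j x) +
        tentChannel (condHam G θ x) (G j x) * NormedSpace.exp (-condHam G θ x))).trace =
      -(G j x * NormedSpace.exp (-condHam G θ x)).trace := by
    intro x
    rw [trace_smul, trace_add, Matrix.trace_mul_comm (tentChannel _ _),
      trace_mul_tentChannel (hH θ x), tentChannel_exp_neg (hH θ x), Matrix.trace_mul_comm (G j x),
      smul_eq_mul]
    ring
  have hZ : HasDerivAt (fun s => (NormedSpace.exp (-ham G (Function.update θ j s))).trace)
      (-∑ x, (G j x * NormedSpace.exp (-condHam G θ x)).trace) (θ j) := by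
    simp only [trace_exp_neg_ham]
    have h := HasDerivAt.fun_sum fun x (_ : x ∈ Finset.univ) => (hE x).trace
    simpa only [htr, Finset.sum_neg_distrib] using h
  have hZ0 := (trace_exp_neg_ham_pos hG θ).ne'
  have hp := prob_smul_condState hG θ
  have hpe : ∀ x, prob G θ x * expect (G j x) (condState G θ x) =
      ((NormedSpace.exp (-ham G θ)).trace)⁻¹ *
        (G j x * NormedSpace.exp (-condHam G θ x)).trace := by
    intro x
    rw [expect, ← smul_eq_mul, ← trace_smul, ← Matrix.mul_smul, hp, Matrix.mul_smul, trace_smul,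
      smul_eq_mul]
  have hps : ∀ x, prob G θ x • (condState G θ x * tentChannel (condHam G θ x) (G j x) +
      tentChannel (condHam G θ x) (G j x) * condState G θ x) =
      ((NormedSpace.exp (-ham G θ)).trace)⁻¹ •
        (NormedSpace.exp (-condHam G θ x) * tentChannel (condHam G θ x) (G j x) +
        tentChannel (condHam G θ x) (G j x) * NormedSpace.exp (-condHam G θ x)) := by
    intro x
    rw [smul_add, ← Matrix.smul_mul, ← Matrix.mul_smul, hp, Matrix.smul_mul, Matrix.mul_smul,
      smul_add]
  intro a b
  have hS := HasDerivAt.fun_sum fun x (_ : x ∈ Finset.univ) => hE x a b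
  have hZ' := hZ.fun_inv (by rwa [Function.update_eq_self])
  have h := hZ'.mul hS
  simp only [Function.update_eq_self] at h
  have hv : (fun s => visState G (Function.update θ j s) a b) =
      fun s => (NormedSpace.exp (-ham G (Function.update θ j s))).trace⁻¹ *
        ∑ x, NormedSpace.exp (-condHam G (Function.update θ j s) x) a b := by
    funext s
    rw [visState_eq, Matrix.smul_apply, Matrix.sum_apply, smul_eq_mul]
  rw [hv]
  convert! h using 1
  simp only [hpe, hps, visState_eq, Matrix.add_apply, Matrix.smul_apply, Matrix.sum_apply,
    smul_eq_mul, ← Finset.mul_sum]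
  field_simp
  ring

lemma trace_mul_half_anticomm {n : Type*} [Fintype n] (T C K : Matrix n n ℂ) :
    (T * ((1 / 2 : ℂ) • (C * K + K * C))).trace = 1 / 2 * (K * (C * T + T * C)).trace := by
  rw [Matrix.mul_smul, trace_smul, smul_eq_mul, Matrix.mul_add, trace_add, Matrix.mul_add,
    trace_add, ← Matrix.mul_assoc T C K, Matrix.trace_mul_comm _ K, Matrix.trace_mul_comm T,
    Matrix.mul_assoc K C T, add_comm]

end QCBoltzmann

/-! ### The gradient formula. -/

open QCBoltzmann

theorem mainTheorem7 {V X J : Type*} [Fintype V] [DecidableEq V] [Fintype X] [DecidableEq X]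
    [Nonempty X] [Fintype J] [DecidableEq J]
    (G : J → X → Matrix V V ℂ) (hG : ∀ j x, (G j x).IsHermitian)
    (ρ : Matrix V V ℂ) (hρ : QCBoltzmann.IsState ρ)
    (q : ℝ) (hq : q ∈ Set.Ioo (0 : ℝ) 1 ∪ Set.Ioc (1 : ℝ) 2)
    (θ : J → ℝ) (j : J) :
    HasDerivAt
      (fun s : ℝ =>
        QCBoltzmann.petzD q ρ (QCBoltzmann.visState G (Function.update θ j s)))
      ((∑ x, QCBoltzmann.prob G θ x *
          QCBoltzmann.expect (G j x)
            (QCBoltzmann.sigmaMap q G θ x (QCBoltzmann.rpow ρ q)))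
        - QCBoltzmann.petzQ q ρ (QCBoltzmann.visState G θ) *
          ∑ x, QCBoltzmann.prob G θ x *
            QCBoltzmann.expect (G j x) (QCBoltzmann.condState G θ x))
      (θ j) := by
  -- A state on the zero space would have trace `0`.
  have : Nonempty V := by
    by_contra h
    rw [not_nonempty_iff] at h
    have h := hρ.2
    simp [Matrix.trace] at h
  have h0 : -1 ≤ 1 - q := by rcases hq with h | h <;> linarith [h.1, h.2]
  have hr : 1 - q ≠ 0 := by
    rcases hq with h | h
    · exact (sub_pos.2 h.2).ne'
    · exact (sub_neg.2 h.1).ne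
  have h1 : 1 - q < 1 := by rcases hq with h | h <;> linarith [h.1]
  have hσ := posDef_visState hG θ
  have hd := ((hasMatDeriv_visState hG θ j).rpow (fun s => posDef_visState hG _) h0 hr h1)
  have hD := ((hd.trace_const_mul (rpow ρ q)).sub_const 1).div_const ((q : ℂ) - 1)
  rw [Function.update_eq_self] at hD
  have hq1 : (q : ℂ) - 1 ≠ 0 := by
    rw [← ofReal_one, ← ofReal_sub, ofReal_ne_zero]
    exact fun h => hr (by linarith)
  have hexp : (1 - q - 1) / 2 = -(q / 2) := by ring
  -- `K` is the dual observable: the derivative of `Q_q` is `(1 - q)` times the trace of `K` against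
  -- the derivative of the visible state.
  set K : Matrix V V ℂ := rpow (visState G θ) (-(q / 2)) *
    powChannel (1 - q) (visState G θ) (rpow ρ q) * rpow (visState G θ) (-(q / 2)) with hK
  -- Moved back onto the visible state, the channel fixes it, and the powers recombine to exponent
  -- `1 - q`.
  have hQ : (K * visState G θ).trace = petzQ q ρ (visState G θ) := by
    rw [hK, ← trace_mul_rpow_powChannel h0 hr h1, powChannel_self h0 hr h1 hσ.1, ← hexp,
      rpow_mul_self_mul_rpow hσ, petzQ]
  have h_sigma : ∀ x, expect (G j x) (sigmaMap q G θ x (rpow ρ q)) =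
      1 / 2 * (K * (condState G θ x * tentChannel (condHam G θ x) (G j x) +
        tentChannel (condHam G θ x) (G j x) * condState G θ x)).trace := by
    intro x
    rw [expect, sigmaMap, trace_mul_tentChannel (isHermitian_condHam hG θ x), xiMap]
    simp only [← hK]
    rw [trace_mul_half_anticomm]
  convert! hD using 1
  rw [Matrix.mul_smul, trace_smul, hexp, trace_mul_rpow_powChannel h0 hr h1, ← hK, Matrix.mul_add,
    trace_add, Matrix.mul_smul, Matrix.mul_smul, trace_smul, trace_smul, hQ, Matrix.mul_sum,
    trace_sum]
  simp only [h_sigma, Matrix.mul_smul, trace_smul, smul_eq_mul]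
  have e : ∑ x, prob G θ x * (1 / 2 * (K * (condState G θ x *
      tentChannel (condHam G θ x) (G j x) +
        tentChannel (condHam G θ x) (G j x) * condState G θ x)).trace) =
      1 / 2 * ∑ x, prob G θ x * (K * (condState G θ x *
      tentChannel (condHam G θ x) (G j x) +
        tentChannel (condHam G θ x) (G j x) * condState G θ x)).trace := by
    rw [Finset.mul_sum]
    exact Finset.sum_congr rfl fun x _ => by ring
  -- The factor `1 - q` of the power rule against `q - 1` leaves `-1`, which flips both signs in the
  -- derivative of the visible state.
  rw [e, eq_div_iff hq1]
  push_cast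
  ring

end
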